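/- **Notation.** Let $\mathbb{D}$ be the open unit disc, $\mathbb{T}$ the unit circle, and $\mathcal{D}'$ the space of distributions on $\mathbb{T}$ (the dual of the space $\mathcal{D}$ of smooth functions on $\mathbb{T}$). For $f\in\mathcal{D}$ put $\hat f(k)=\frac1{2\pi}\int_0^{2\pi}f(e^{it})e^{-ikt}\,dt$, and for $\mu\in\mathcal{D}'$ put $\hat\mu(k)=\mu(\zeta^{-k})$, $k\in\mathbb{Z}$. The Poisson extension of $\mu$ is $P_\mu(z)=\sum_{k\ge0}\hat\mu(k)z^k+\sum_{k\ge1}\hat\mu(-k)\bar z^k$, $|z|<1$. A distribution $\mu$ is *real* if $\mu(g)\in\mathbb{R}$ for every real-valued $g\in\mathcal{D}$, and *positive* ($\mu\ge0$) if $\mu(g)\ge0$ for every $g\in\mathcal{D}$ with $g\ge0$; it *is a finite measure* if it is integration against a finite complex Borel measure on $\mathbb{T}$. The operator $D:\mathcal{D}'\to\mathcal{D}'$ is given by $\widehat{D\mu}(k)=|k|\hat\mu(k)$. Let $\mathcal{D}_a$ be the space of functions that are analytic on $\mathbb{D}$ and smooth on $\overline{\mathbb{D}}$. For $\mu\in\mathcal{D}'$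 and $f\in\mathcal{D}_a$ let $$\mathcal{D}_{\mu,0}(f)=\lim_{r\to1^-}\frac1{2\pi}\int_0^{2\pi}|f(re^{it})|^2P_\mu(re^{it})\,dt,$$ $$\mathcal{D}_{\mu,n}(f)=\lim_{r\to1^-}\frac{1}{n!\,(n-1)!\,\pi}\int_{r\mathbb{D}}|f^{(n)}(z)|^2P_\mu(z)(1-|z|^2)^{n-1}\,dA(z),\qquad n\ge1$$ (these limits exist). For $\boldsymbol\mu=(\mu_0,\dots,\mu_{m-1})\in(\mathcal{D}')^m$ put $\|f\|_{\boldsymbol\mu}^2=\sum_{n=0}^{m-1}\mathcal{D}_{\mu_n,n}(f)$. The tuple $\boldsymbol\mu$ is *allowable* if there is $C>0$ such that $0\le\|zf\|_{\boldsymbol\mu}^2\le C^2\|f\|_{\boldsymbol\mu}^2$ for all $f\in\mathcal{D}_a$. For $\mu\in\mathcal{D}'$, $\mu e_n$ is the $m$-tuple whose entry with index $n$ is $\mu$ and whose other entries are $0$. **Theorem.** Let $m\ge4$, let $\boldsymbol\mu=(\mu_0,\dots,\mu_{m-1})$ be a tuple of real distributions on $\mathbb{T}$, and let $\nu\in\mathcal{D}'$.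 Assume that 1. $\nu\ge0$, and there is a constant $K$ with $|\hat f(0)|^2\le K\,\mathcal{D}_{\nu,0}(f)$ for all $f\in\mathcal{D}_a$; 2. if $0\le n\le\frac{m-4}{2}$, then there is a constant $K_n$ with $|\hat\mu_n(k)|\le K_n(1+|k|)^{\frac{m-4}{2}}$ for all $k\in\mathbb{Z}$; 3. if $m$ is odd and $n=\frac{m-3}{2}$, then $\mu_n=\sum_{j=0}^{\frac{m-5}{2}}D^j\nu_j$ for some finite measures $\nu_j$; 4. if $\frac{m-2}{2}\le n\le m-3$, then $\mu_n=\sum_{j=0}^{m-3-n}D^j\nu_j$ for some finite measures $\nu_j$ (depending on $n$); moreover $\mu_{m-2}=0$; 5. $\mu_{m-1}\ge0$ and $\mu_{m-1}\ne0$. Then there is $C_0>0$ such that for every real $C\ge C_0$ the tuple $C\nu e_0+\boldsymbol\mu+C\mu_{m-1}e_{m-1}$ is allowable. -/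

import Mathlib

open scoped ContDiff ComplexOrder

noncomputable section

namespace CircleDist

/-! ### Smooth functions on the unit circle -/

/-- The space `𝒟` of smooth functions `f : 𝕋 → ℂ`: those for which `t ↦ f (e^{it})` is smooth. -/
def TestFunction : Submodule ℂ (Circle → ℂ) where
  carrier := {f | ContDiff ℝ ∞ fun t : ℝ => f (Circle.exp t)}
  add_mem' := fun {f g} (hf : ContDiff ℝ ∞ fun t : ℝ => f (Circle.exp t))
    (hg : ContDiff ℝ ∞ fun t : ℝ => g (Circle.exp t)) => hf.add hg
  zero_mem' := (contDiff_const : ContDiff ℝ ∞ fun _ : ℝ => (0 : ℂ))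
  smul_mem' := fun c f (hf : ContDiff ℝ ∞ fun t : ℝ => f (Circle.exp t)) => hf.const_smul c

/-- The Fourier coefficient `f̂(k) = (1/2π) ∫_𝕋 f(ζ) ζ̄^k dλ(ζ)` (`λ` is arc length). -/
def circleCoeff (f : Circle → ℂ) (k : ℤ) : ℂ :=
  (2 * Real.pi : ℂ)⁻¹ *
    ∫ t in (0 : ℝ)..(2 * Real.pi), f (Circle.exp t) * (Circle.exp t : ℂ) ^ (-k)

/-- The seminorm `‖f‖_α = (∑_{k ∈ ℤ} |f̂(k)|² (1+|k|)^α)^{1/2}`; the series converges for every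
smooth `f`, see `summable_seminorm`. -/
def seminorm (α : ℕ) (f : TestFunction) : ℝ :=
  Real.sqrt (∑' k : ℤ, ‖circleCoeff f k‖ ^ 2 * (1 + |(k : ℝ)|) ^ α)

/-- The monomial `ζ ↦ ζ ^ k`, `k ∈ ℤ`. -/
def monomial (k : ℤ) : TestFunction :=
  ⟨fun ζ => (ζ : ℂ) ^ k, by
    change ContDiff ℝ ∞ fun t : ℝ => (Circle.exp t : ℂ) ^ k
    have : (fun t : ℝ => (Circle.exp t : ℂ) ^ k) =
        fun t : ℝ => Complex.exp ((k : ℂ) * (t * Complex.I)) := by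
      funext t; rw [Circle.coe_exp, ← Complex.exp_int_mul]
    rw [this]
    exact (contDiff_const.mul (Complex.ofRealCLM.contDiff.mul contDiff_const)).cexp⟩

/-! Decay of the Fourier coefficients of smooth functions. -/

theorem circleCoeff_eq (f : Circle → ℂ) (k : ℤ) :
    circleCoeff f k = (2 * Real.pi : ℂ)⁻¹ *
      ∫ t in (0 : ℝ)..(2 * Real.pi), f (Circle.exp t) * Complex.exp (-(k * Complex.I) * t) := by
  unfold circleCoeff
  congr 2
  funext t
  rw [Circle.coe_exp, ← Complex.exp_int_mul]
  congr 2
  push_cast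
  ring

theorem circleCoeff_add (f g : TestFunction) (k : ℤ) :
    circleCoeff ((f + g : TestFunction) : Circle → ℂ) k =
      circleCoeff f k + circleCoeff g k := by
  have hi : ∀ f : TestFunction, IntervalIntegrable
      (fun t : ℝ => (f : Circle → ℂ) (Circle.exp t) * Complex.exp (-(k * Complex.I) * t))
      MeasureTheory.volume 0 (2 * Real.pi) := fun f =>
    ((show ContDiff ℝ ∞ fun t : ℝ => (f : Circle → ℂ) (Circle.exp t) from f.2).continuous.mul
      (by fun_prop)).intervalIntegrable _ _
  simp only [circleCoeff_eq]
  rw [← mul_add, ← intervalIntegral.integral_add (hi f) (hi g)]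
  simp [add_mul]

theorem circleCoeff_smul (c : ℂ) (f : TestFunction) (k : ℤ) :
    circleCoeff ((c • f : TestFunction) : Circle → ℂ) k = c * circleCoeff f k := by
  simp only [circleCoeff_eq]
  rw [mul_left_comm, ← intervalIntegral.integral_const_mul]
  simp [mul_assoc]

theorem integral_deriv_mul_exp (g : ℝ → ℂ) (hg : ContDiff ℝ ∞ g)
    (hp : Function.Periodic g (2 * Real.pi)) (k : ℤ) :
    ∫ t in (0 : ℝ)..(2 * Real.pi), deriv g t * Complex.exp (-(k * Complex.I) * t) =
      (k * Complex.I) *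
        ∫ t in (0 : ℝ)..(2 * Real.pi), g t * Complex.exp (-(k * Complex.I) * t) := by
  have hd : Differentiable ℝ g := hg.differentiable (by simp)
  have hv : ∀ t : ℝ, HasDerivAt (fun t : ℝ => Complex.exp (-(k * Complex.I) * t))
      (Complex.exp (-(k * Complex.I) * t) * (-(k * Complex.I))) t := fun t => by
    have h := ((hasDerivAt_id t).ofReal_comp.const_mul (-(k * Complex.I))).cexp
    simpa using h
  have hc : Continuous (deriv g) := hg.continuous_deriv (by simp)
  have key := intervalIntegral.integral_deriv_mul_eq_sub (a := 0) (b := 2 * Real.pi)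
    (u := g) (v := fun t : ℝ => Complex.exp (-(k * Complex.I) * t))
    (u' := deriv g) (v' := fun t => Complex.exp (-(k * Complex.I) * t) * (-(k * Complex.I)))
    (fun t _ => (hd t).hasDerivAt) (fun t _ => hv t)
    (hc.intervalIntegrable _ _) ((by fun_prop : Continuous _).intervalIntegrable _ _)
  have he : Complex.exp (-(k * Complex.I) * ((2 * Real.pi : ℝ) : ℂ)) = 1 := by
    have := Complex.exp_int_mul_two_pi_mul_I (-k)
    rw [← this]; congr 1; push_cast; ring
  have hg0 : g (2 * Real.pi) = g 0 := by simpa using hp 0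
  rw [he, hg0] at key
  rw [intervalIntegral.integral_add] at key
  · simp only [Complex.ofReal_zero, mul_zero, Complex.exp_zero, sub_self] at key
    rw [eq_neg_of_add_eq_zero_left key, ← intervalIntegral.integral_neg,
      ← intervalIntegral.integral_const_mul]
    congr 1; funext t; ring
  · exact (hc.mul (by fun_prop)).intervalIntegrable _ _
  · exact (hd.continuous.mul (by fun_prop)).intervalIntegrable _ _

theorem integral_iteratedDeriv_mul_exp (N : ℕ) : ∀ (g : ℝ → ℂ), ContDiff ℝ ∞ g →
    Function.Periodic g (2 * Real.pi) → ∀ k : ℤ,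
    ∫ t in (0 : ℝ)..(2 * Real.pi), iteratedDeriv N g t * Complex.exp (-(k * Complex.I) * t) =
      (k * Complex.I) ^ N *
        ∫ t in (0 : ℝ)..(2 * Real.pi), g t * Complex.exp (-(k * Complex.I) * t) := by
  induction N with
  | zero => intro g _ _ k; simp
  | succ N ih =>
    intro g hg hp k
    have hp' : Function.Periodic (deriv g) (2 * Real.pi) := fun t => by
      have : (fun s => g (s + 2 * Real.pi)) = g := funext hp
      rw [← deriv_comp_add_const, this]
    rw [iteratedDeriv_succ', ih (deriv g) (contDiff_infty_iff_deriv.1 hg).2 hp' k,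
      integral_deriv_mul_exp g hg hp k, pow_succ]
    ring

theorem circleCoeff_decay (f : TestFunction) (N : ℕ) :
    ∃ B : ℝ, ∀ k : ℤ, (1 + |(k : ℝ)|) ^ N * ‖circleCoeff f k‖ ≤ B := by
  set g : ℝ → ℂ := fun t => (f : Circle → ℂ) (Circle.exp t) with hgdef
  have hg : ContDiff ℝ ∞ g := f.2
  have hp : Function.Periodic g (2 * Real.pi) := fun t => by
    simp [hgdef, Circle.exp_add]
  have main : ∀ M : ℕ, ∃ B : ℝ, ∀ k : ℤ, |(k : ℝ)| ^ M * ‖circleCoeff f k‖ ≤ B := by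
    intro M
    have hc : Continuous (iteratedDeriv M g) :=
      hg.continuous_iteratedDeriv M (by exact_mod_cast le_top)
    obtain ⟨B, hB⟩ := isCompact_Icc.exists_bound_of_continuousOn
      (s := Set.Icc (0 : ℝ) (2 * Real.pi)) hc.continuousOn
    refine ⟨‖(2 * Real.pi : ℂ)⁻¹‖ * (B * |2 * Real.pi - 0|), fun k => ?_⟩
    have h1 := integral_iteratedDeriv_mul_exp M g hg hp k
    have h2 : ‖∫ t in (0 : ℝ)..(2 * Real.pi),
        iteratedDeriv M g t * Complex.exp (-(k * Complex.I) * t)‖ ≤ B * |2 * Real.pi - 0| := by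
      refine intervalIntegral.norm_integral_le_of_norm_le_const fun t ht => ?_
      rw [Set.uIoc_of_le Real.two_pi_pos.le] at ht
      have : ‖Complex.exp (-(k * Complex.I) * t)‖ = 1 := by
        rw [Complex.norm_exp]; simp
      rw [norm_mul, this, mul_one]
      exact hB t ⟨ht.1.le, ht.2⟩
    rw [h1, norm_mul] at h2
    rw [circleCoeff_eq, norm_mul, mul_left_comm]
    refine mul_le_mul_of_nonneg_left ?_ (norm_nonneg _)
    simpa using h2
  obtain ⟨B0, h0⟩ := main 0
  obtain ⟨BN, hN⟩ := main N
  refine ⟨2 ^ N * (B0 + BN), fun k => ?_⟩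
  have h0' := h0 k
  have hN' := hN k
  have hk : (0 : ℝ) ≤ |(k : ℝ)| := abs_nonneg _
  have h3 : (1 + |(k : ℝ)|) ^ N ≤ 2 ^ N * (1 + |(k : ℝ)| ^ N) := by
    rcases le_total (|(k : ℝ)|) 1 with h | h
    · calc (1 + |(k : ℝ)|) ^ N ≤ 2 ^ N := by gcongr; linarith
        _ ≤ 2 ^ N * (1 + |(k : ℝ)| ^ N) := by
          nlinarith [pow_nonneg hk N, pow_pos (two_pos (α := ℝ)) N]
    · calc (1 + |(k : ℝ)|) ^ N ≤ (2 * |(k : ℝ)|) ^ N := by gcongr; linarith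
        _ ≤ 2 ^ N * (1 + |(k : ℝ)| ^ N) := by
          rw [mul_pow]; nlinarith [pow_pos (two_pos (α := ℝ)) N]
  calc (1 + |(k : ℝ)|) ^ N * ‖circleCoeff f k‖
      ≤ 2 ^ N * (1 + |(k : ℝ)| ^ N) * ‖circleCoeff f k‖ := by gcongr
    _ = 2 ^ N * (|(k : ℝ)| ^ 0 * ‖circleCoeff f k‖ + |(k : ℝ)| ^ N * ‖circleCoeff f k‖) := by
        ring
    _ ≤ 2 ^ N * (B0 + BN) := by gcongr

theorem summable_inv_sq : Summable fun k : ℤ => ((1 + |(k : ℝ)|) ^ 2)⁻¹ := by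
  have h : Summable fun n : ℕ => ((1 + (n : ℝ)) ^ 2)⁻¹ := by
    have := (summable_nat_add_iff 1).2 (Real.summable_nat_pow_inv.2 one_lt_two)
    simpa [add_comm] using this
  refine Summable.of_nat_of_neg ?_ ?_ <;> simpa using h

/-- The series that defines the seminorm `‖f‖_α` converges. -/
theorem summable_seminorm (α : ℕ) (f : TestFunction) :
    Summable fun k : ℤ => ‖circleCoeff f k‖ ^ 2 * (1 + |(k : ℝ)|) ^ α := by
  obtain ⟨B, hB⟩ := circleCoeff_decay f (α + 1)
  refine Summable.of_nonneg_of_le (fun k => by positivity) (fun k => ?_)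
    (summable_inv_sq.mul_left (B ^ 2))
  have hk : (1 : ℝ) ≤ 1 + |(k : ℝ)| := by linarith [abs_nonneg (k : ℝ)]
  rw [← div_eq_mul_inv, le_div_iff₀ (by positivity)]
  calc ‖circleCoeff f k‖ ^ 2 * (1 + |(k : ℝ)|) ^ α * (1 + |(k : ℝ)|) ^ 2
      ≤ ‖circleCoeff f k‖ ^ 2 * (1 + |(k : ℝ)|) ^ (2 * α) * (1 + |(k : ℝ)|) ^ 2 := by
        gcongr
        omega
    _ = ((1 + |(k : ℝ)|) ^ (α + 1) * ‖circleCoeff f k‖) ^ 2 := by ring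
    _ ≤ B ^ 2 := by gcongr; exact hB k

theorem seminorm_mono {α β : ℕ} (h : α ≤ β) (f : TestFunction) :
    seminorm α f ≤ seminorm β f := by
  refine Real.sqrt_le_sqrt ((summable_seminorm α f).tsum_le_tsum (fun k => ?_)
    (summable_seminorm β f))
  have hk : (1 : ℝ) ≤ 1 + |(k : ℝ)| := by linarith [abs_nonneg (k : ℝ)]
  gcongr

theorem seminorm_nonneg (α : ℕ) (f : TestFunction) : 0 ≤ seminorm α f := Real.sqrt_nonneg _

theorem circleCoeff_le_seminorm (N : ℕ) (f : TestFunction) (k : ℤ) :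
    (1 + |(k : ℝ)|) ^ N * ‖circleCoeff f k‖ ≤ seminorm (2 * N) f := by
  refine Real.le_sqrt_of_sq_le ?_
  refine le_trans (le_of_eq ?_)
    ((summable_seminorm (2 * N) f).le_tsum k fun j _ => by positivity)
  ring

theorem circleCoeff_monomial (k l : ℤ) :
    circleCoeff (monomial k) l = if l = k then 1 else 0 := by
  have h1 : ∀ t : ℝ, (monomial k : Circle → ℂ) (Circle.exp t) *
      Complex.exp (-(l * Complex.I) * t) = Complex.exp (((k - l : ℤ) * Complex.I) * t) := by
    intro t
    change (Circle.exp t : ℂ) ^ k * _ = _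
    rw [Circle.coe_exp, ← Complex.exp_int_mul, ← Complex.exp_add]
    congr 1; push_cast; ring
  rw [circleCoeff_eq]
  simp only [h1]
  split_ifs with h
  · subst h
    have : (Real.pi : ℂ) ≠ 0 := by exact_mod_cast Real.pi_ne_zero
    simp
    field_simp
  · have h2 : ((k - l : ℤ) * Complex.I : ℂ) ≠ 0 :=
      mul_ne_zero (by exact_mod_cast sub_ne_zero.2 (Ne.symm h)) Complex.I_ne_zero
    rw [integral_exp_mul_complex h2]
    have he : Complex.exp (((k - l : ℤ) * Complex.I) * ((2 * Real.pi : ℝ) : ℂ)) = 1 := by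
      have := Complex.exp_int_mul_two_pi_mul_I (k - l)
      rw [← this]; congr 1; push_cast; ring
    rw [he]; simp

theorem seminorm_monomial (α : ℕ) (k : ℤ) :
    seminorm α (monomial k) = Real.sqrt ((1 + |(k : ℝ)|) ^ α) := by
  unfold seminorm
  rw [tsum_eq_single k fun l hl => by simp [circleCoeff_monomial, hl]]
  simp [circleCoeff_monomial]

/-! ### Distributions on the unit circle -/

/-- The space `𝒟'` of distributions on `𝕋`: linear functionals on `𝒟` that are continuous with
respect to the seminorms `‖·‖_α`.  As these increase with `α`, continuity means that the functional
is bounded by a multiple of one of them. -/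
def distributions : Submodule ℂ (TestFunction →ₗ[ℂ] ℂ) where
  carrier := {μ | ∃ α : ℕ, ∃ C : ℝ, ∀ f, ‖μ f‖ ≤ C * seminorm α f}
  add_mem' := by
    rintro μ ν ⟨α, C, h⟩ ⟨β, K, h'⟩
    refine ⟨max α β, |C| + |K|, fun f => ?_⟩
    have h1 : C * seminorm α f ≤ |C| * seminorm (max α β) f :=
      mul_le_mul (le_abs_self C) (seminorm_mono (le_max_left _ _) f) (seminorm_nonneg _ _)
        (abs_nonneg _)
    have h2 : K * seminorm β f ≤ |K| * seminorm (max α β) f :=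
      mul_le_mul (le_abs_self K) (seminorm_mono (le_max_right _ _) f) (seminorm_nonneg _ _)
        (abs_nonneg _)
    calc ‖μ f + ν f‖ ≤ ‖μ f‖ + ‖ν f‖ := norm_add_le _ _
      _ ≤ (|C| + |K|) * seminorm (max α β) f := by linarith [h f, h' f]
  zero_mem' := ⟨0, 0, fun f => by simp⟩
  smul_mem' := by
    rintro c μ ⟨α, C, h⟩
    refine ⟨α, ‖c‖ * C, fun f => ?_⟩
    calc ‖c • μ f‖ = ‖c‖ * ‖μ f‖ := norm_smul _ _
      _ ≤ ‖c‖ * (C * seminorm α f) := by gcongr; exact h f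
      _ = ‖c‖ * C * seminorm α f := by ring

/-- The type of distributions on `𝕋`. -/
abbrev Distribution : Type := ↥distributions

/-- The circle carries its Borel σ-algebra. -/
instance : MeasurableSpace Circle := borel Circle

instance : BorelSpace Circle := ⟨rfl⟩

namespace Distribution

/-- The action `μ(f)` of a distribution on a smooth function. -/
def eval (μ : Distribution) (f : TestFunction) : ℂ := (μ : TestFunction →ₗ[ℂ] ℂ) f

/-- The Fourier coefficient `μ̂(k) = μ(ζ^{-k})`. -/
def hat (μ : Distribution) (k : ℤ) : ℂ := μ.eval (monomial (-k))

/-- `μ ≥ 0`: the distribution is non-negative on non-negative smooth functions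
(the order of `ℂ` is used: `0 ≤ w` says that `w` is real and non-negative). -/
def IsPositive (μ : Distribution) : Prop :=
  ∀ f : TestFunction, (∀ ζ, 0 ≤ (f : Circle → ℂ) ζ) → 0 ≤ μ.eval f

/-- `μ` is a real distribution: it is real-valued on real-valued smooth functions. -/
def IsReal (μ : Distribution) : Prop :=
  ∀ f : TestFunction, (∀ ζ, ((f : Circle → ℂ) ζ).im = 0) → (μ.eval f).im = 0

/-- `μ` *is* a finite (complex) measure `σ`: it is integration against `σ = Re σ + i Im σ`. -/
def IsFiniteMeasure (μ : Distribution) : Prop :=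
  ∃ σ : MeasureTheory.ComplexMeasure Circle, ∀ f : TestFunction,
    μ.eval f = (∫ᵛ ζ, (f : Circle → ℂ) ζ ∂<•(MeasureTheory.ComplexMeasure.re σ)) +
      Complex.I * ∫ᵛ ζ, (f : Circle → ℂ) ζ ∂<•(MeasureTheory.ComplexMeasure.im σ)

theorem exists_hat_bound (μ : Distribution) :
    ∃ N : ℕ, ∃ C : ℝ, 0 ≤ C ∧ ∀ k : ℤ, ‖μ.hat k‖ ≤ C * (1 + |(k : ℝ)|) ^ N := by
  obtain ⟨α, C, h⟩ := μ.2
  refine ⟨α, |C|, abs_nonneg _, fun k => (h _).trans ?_⟩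
  rw [seminorm_monomial]
  have hk : (1 : ℝ) ≤ (1 + |(k : ℝ)|) ^ α := one_le_pow₀ (by linarith [abs_nonneg (k : ℝ)])
  have hs : Real.sqrt ((1 + |((-k : ℤ) : ℝ)|) ^ α) ≤ (1 + |(k : ℝ)|) ^ α := by
    rw [Int.cast_neg, abs_neg]
    exact Real.sqrt_le_iff.2 ⟨by linarith, by nlinarith⟩
  exact mul_le_mul (le_abs_self C) hs (Real.sqrt_nonneg _) (abs_nonneg _)

theorem derivTerm_bound (μ : Distribution) :
    ∃ N : ℕ, ∃ C : ℝ, 0 ≤ C ∧ ∀ (f : TestFunction) (k : ℤ),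
      ‖((|k| : ℤ) : ℂ) * μ.hat k * circleCoeff f (-k)‖ ≤
        C * seminorm N f * ((1 + |(k : ℝ)|) ^ 2)⁻¹ := by
  obtain ⟨N, C, hC, h⟩ := μ.exists_hat_bound
  refine ⟨2 * (N + 3), C, hC, fun f k => ?_⟩
  have h1 := circleCoeff_le_seminorm (N + 3) f (-k)
  rw [Int.cast_neg, abs_neg] at h1
  have hk0 := abs_nonneg (k : ℝ)
  have h2 : ‖((|k| : ℤ) : ℂ)‖ ≤ 1 + |(k : ℝ)| := by
    rw [Complex.norm_intCast]; push_cast; rw [abs_abs]; linarith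
  rw [← div_eq_mul_inv, le_div_iff₀ (by positivity), norm_mul, norm_mul]
  calc ‖((|k| : ℤ) : ℂ)‖ * ‖μ.hat k‖ * ‖circleCoeff f (-k)‖ * (1 + |(k : ℝ)|) ^ 2
      ≤ (1 + |(k : ℝ)|) * (C * (1 + |(k : ℝ)|) ^ N) * ‖circleCoeff f (-k)‖ *
          (1 + |(k : ℝ)|) ^ 2 := by
        gcongr; exact h k
    _ = C * ((1 + |(k : ℝ)|) ^ (N + 3) * ‖circleCoeff f (-k)‖) := by ring
    _ ≤ C * seminorm (2 * (N + 3)) f := by gcongr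

theorem summable_derivTerm (μ : Distribution) (f : TestFunction) :
    Summable fun k : ℤ => ((|k| : ℤ) : ℂ) * μ.hat k * circleCoeff f (-k) := by
  obtain ⟨N, C, _, h⟩ := μ.derivTerm_bound
  exact Summable.of_norm_bounded (summable_inv_sq.mul_left _) (h f)

/-- The operator `D : 𝒟' → 𝒟'` with `(Dμ)^(k) = |k| μ̂(k)`, see `hat_D`; a distribution `κ` acts
by `κ(f) = ∑_k κ̂(k) f̂(-k)`. -/
def D (μ : Distribution) : Distribution :=
  ⟨{ toFun := fun f => ∑' k : ℤ, ((|k| : ℤ) : ℂ) * μ.hat k * circleCoeff f (-k)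
     map_add' := fun f g => by
       rw [← (μ.summable_derivTerm f).tsum_add (μ.summable_derivTerm g)]
       simp only [circleCoeff_add, mul_add]
     map_smul' := fun c f => by
       simp only [RingHom.id_apply, smul_eq_mul]
       rw [← tsum_mul_left]
       congr 1; funext k; rw [circleCoeff_smul]; ring },
    by
      obtain ⟨N, C, _, h⟩ := μ.derivTerm_bound
      refine ⟨N, C * ∑' k : ℤ, ((1 + |(k : ℝ)|) ^ 2)⁻¹, fun f => ?_⟩
      have := tsum_of_norm_bounded (summable_inv_sq.hasSum.mul_left (C * seminorm N f)) (h f)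
      refine this.trans (le_of_eq ?_)
      ring⟩

theorem hat_D (μ : Distribution) (k : ℤ) : μ.D.hat k = ((|k| : ℤ) : ℂ) * μ.hat k := by
  change ∑' l : ℤ, ((|l| : ℤ) : ℂ) * μ.hat l * circleCoeff (monomial (-k)) (-l) = _
  rw [tsum_eq_single k fun l hl => by simp [circleCoeff_monomial, hl]]
  simp [circleCoeff_monomial]

/-- The Poisson extension
`P_μ(z) = ∑_{k ≥ 0} μ̂(k) z^k + ∑_{k ≥ 1} μ̂(-k) z̄^k`, for `|z| < 1`. -/
def poisson (μ : Distribution) (z : ℂ) : ℂ :=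
  (∑' k : ℕ, μ.hat k * z ^ k) +
    ∑' k : ℕ, μ.hat (-((k : ℤ) + 1)) * (starRingEnd ℂ z) ^ (k + 1)

end Distribution

/-! ### Dirichlet integrals and allowable tuples -/

/-- `f ∈ 𝒟_a`: `f` is analytic on the open unit disc and smooth on its closure
(the values of `f` off the closed disc are irrelevant). -/
def IsSmoothAnalytic (f : ℂ → ℂ) : Prop :=
  DifferentiableOn ℂ f (Metric.ball 0 1) ∧ ContDiffOn ℝ ∞ f (Metric.closedBall 0 1)

/-- The Taylor coefficient `f̂(k)` of `f ∈ 𝒟_a`, as the Fourier coefficient of `f` on `𝕋`. -/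
def hatA (f : ℂ → ℂ) (k : ℤ) : ℂ := circleCoeff (fun ζ : Circle => f ζ) k

/-- The weighted Dirichlet integral `𝒟_{μ,n}(f)` of order `n`.  For `n = 0` it is the limit, as
`r → 1⁻`, of the means of `|f|² P_μ` over the circles of radius `r` about `0`; for `n ≥ 1` it is the
limit of `1 / (n! (n-1)! π) ∫_{r𝔻} |f⁽ⁿ⁾(z)|² P_μ(z) (1-|z|²)^{n-1} dA(z)`. -/
def dirichletIntegral (μ : Distribution) : ℕ → (ℂ → ℂ) → ℂ
  | 0, f => Filter.limUnder (nhdsWithin (1 : ℝ) (Set.Iio 1)) fun r : ℝ =>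
      Real.circleAverage (fun z : ℂ => ((‖f z‖ ^ 2 : ℝ) : ℂ) * μ.poisson z) 0 r
  | n + 1, f => Filter.limUnder (nhdsWithin (1 : ℝ) (Set.Iio 1)) fun r : ℝ =>
      ((((n + 1).factorial * n.factorial : ℕ) : ℂ) * (Real.pi : ℂ))⁻¹ *
        ∫ z in Metric.ball (0 : ℂ) r,
          ((‖iteratedDeriv (n + 1) f z‖ ^ 2 : ℝ) : ℂ) * μ.poisson z *
            (((1 - ‖z‖ ^ 2) ^ n : ℝ) : ℂ)

/-- The quadratic form `‖f‖²_μ = ∑_{n=0}^{m-1} 𝒟_{μ_n,n}(f)` of an `m`-tuple of distributions. -/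
def normSq {m : ℕ} (μ : Fin m → Distribution) (f : ℂ → ℂ) : ℂ :=
  ∑ n : Fin m, dirichletIntegral (μ n) n f

/-- The tuple `μ` is allowable: there is `C > 0` with `0 ≤ ‖M_z f‖²_μ ≤ C² ‖f‖²_μ` for all
`f ∈ 𝒟_a`, where `(M_z f)(z) = z f(z)`.  The inequalities are in the order of `ℂ`, so they include
that both sides are real. -/
def Allowable {m : ℕ} (μ : Fin m → Distribution) : Prop :=
  ∃ C : ℝ, 0 < C ∧ ∀ f : ℂ → ℂ, IsSmoothAnalytic f →
    0 ≤ normSq μ (fun z => z * f z) ∧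
      normSq μ (fun z => z * f z) ≤ (C : ℂ) ^ 2 * normSq μ f

/-- `μ = ∑_{j=0}^{J} D^j ν_j` for some finite measures `ν_0, …, ν_J`. -/
def IsSumOfDerivatives (μ : Distribution) (J : ℕ) : Prop :=
  ∃ ν : ℕ → Distribution, (∀ j, (ν j).IsFiniteMeasure) ∧
    μ = ∑ j ∈ Finset.range (J + 1), Distribution.D^[j] (ν j)

end CircleDist

end

/-!
# Allowable tuples of distributions on the circle

For `f = ∑ a_k z^k` in `𝒟_a`, polar coordinates and a beta integral turn the Dirichlet integrals
into quadratic forms in the Taylor coefficients (`dirichletIntegral_eq`):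
`𝒟_{μ,n}(f) = ∑_{i,j} C(min(i,j), n) μ̂(j - i) a_i ā_j`.
By Pascal's rule `𝒟_{μ,n}(zf) = 𝒟_{μ,n}(f) + 𝒟_{μ,n-1}(f)`, so allowability of a tuple says that its
form `F(f)` is nonnegative and dominates the increment `G(f) = ∑_{n ≥ 1} 𝒟_{μ_n,n-1}(f)`
(`allowable_of_dirForm_le`). Both inequalities are proved for finite sections, with constants
that do not depend on the section, and then pass to the limit.

Put `p = m - 2`, `V = 𝒟_{ν,0}(f)` and `R = 𝒟_{μ_{m-1},m-1}(f)`. The hockey-stick identity gives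
`𝒟_{μ,n+1}(f) = ∑_k C(k, n) 𝒟_{μ,0}(L^{k+1} f)` with the backward shift `L` (`dirForm_succ`). For
positive `μ` all the terms are nonnegative, since `𝒟_{μ,0}(g) = μ(|g|²)`, and the parallelogram law
for this semi-norm yields two facts.
* `R` bounds `∑_{k > p} k^p |a_k|²` up to a constant. The remaining coefficients are controlled by
  `V`, because control of `f̂(0)` propagates to all of them by translation invariance
  (`PosSeq.exists_norm_sq_le`). Hence `V + R` dominates the Sobolev norm `∑ (1 + k)^p |a_k|²`
  (`exists_sobolev_le`).
* `𝒟_{μ_{m-1},m-2}(f)`, the top term of `G`, is at most a multiple of `V + R`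
  (`PosSeq.dirForm_re_le_succ`).

The hypotheses on `μ_n` for `n ≤ m - 3` enter only through the growth of `μ̂_n`: coefficients of
finite measures are bounded, and `D` multiplies them by `|k|`. The growth is small enough for the form of
`μ_n` of order `n`, and then also that of order `n - 1`, to be bounded by the same Sobolev norm.
This is a Schur-type estimate which reduces to a Hardy inequality for the kernel `1 / (1 + max(i, j))`
(`hardy_max`, `norm_dirForm_le`). Thus for large `C` the terms `C (V + R)` absorb all others, and
`V + R ≤ F` and `G ≤ C₁ F` follow (`exists_allowable_bounds`).
-/

namespace CircleDist

open Finset Filter Topology MeasureTheory ComplexConjugate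

/-! ### Finite sections of the Dirichlet forms -/

/-- The finite section, over the index set `s`, of the quadratic form
`a ↦ ∑_{i,j} C(min(i,j), n) c(j - i) a_i ā_j`. For `c = μ̂` the full double series is
the Dirichlet integral of order `n` of `∑ a_k z^k`, see `dirichletIntegral_eq`. -/
noncomputable def dirForm (c : ℤ → ℂ) (n : ℕ) (s : Finset ℕ) (a : ℕ → ℂ) : ℂ :=
  ∑ i ∈ s, ∑ j ∈ s, ((min i j).choose n : ℂ) * c ((j : ℤ) - i) * (a i * conj (a j))

/-- The sequence `c` on `ℤ` is positive definite: all finite sections of its Toeplitz form are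
nonnegative. The order is that of `ℂ`, so the sections are in particular real. -/
def PosSeq (c : ℤ → ℂ) : Prop := ∀ (s : Finset ℕ) (a : ℕ → ℂ), 0 ≤ dirForm c 0 s a

theorem dirForm_zero_insert (c : ℤ → ℂ) {s : Finset ℕ} {k : ℕ} (hk : k ∉ s) (a : ℕ → ℂ) :
    dirForm c 0 (insert k s) a = c 0 * (a k * conj (a k)) +
      ∑ j ∈ s, c ((j : ℤ) - k) * (a k * conj (a j)) +
      ∑ i ∈ s, c ((k : ℤ) - i) * (a i * conj (a k)) + dirForm c 0 s a := by
  simp only [dirForm, Nat.choose_zero_right, Nat.cast_one, one_mul, sum_insert hk,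
    sum_add_distrib, sub_self]
  ring

theorem dirForm_zero_scale (c : ℤ → ℂ) {s : Finset ℕ} {k : ℕ} (hk : k ∉ s) (a : ℕ → ℂ)
    (x y : ℝ) :
    dirForm c 0 (insert k s) (fun i => if i = k then x * a i else y * a i) =
      x ^ 2 * (c 0 * (a k * conj (a k))) +
      x * y * (∑ j ∈ s, c ((j : ℤ) - k) * (a k * conj (a j))) +
      x * y * (∑ i ∈ s, c ((k : ℤ) - i) * (a i * conj (a k))) + y ^ 2 * dirForm c 0 s a := by
  have hne : ∀ i ∈ s, i ≠ k := fun i hi h => hk (h ▸ hi)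
  rw [dirForm_zero_insert c hk]
  simp only [dirForm, Nat.choose_zero_right, Nat.cast_one, one_mul, mul_sum]
  congr 1
  · congr 1
    · congr 1
      · simp; ring
      · refine sum_congr rfl fun j hj => ?_
        simp [hne j hj]; ring
    · refine sum_congr rfl fun j hj => ?_
      simp [hne j hj]; ring
  · refine sum_congr rfl fun i hi => sum_congr rfl fun j hj => ?_
    simp [hne j hj, hne i hi]; ring

theorem re_zero_mul_conj (c : ℤ → ℂ) (z : ℂ) : (c 0 * (z * conj z)).re = (c 0).re * ‖z‖ ^ 2 := by
  rw [Complex.mul_conj, Complex.normSq_eq_norm_sq, Complex.re_mul_ofReal]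

namespace PosSeq

variable {c : ℤ → ℂ}

theorem re_nonneg (hc : PosSeq c) (s : Finset ℕ) (a : ℕ → ℂ) : 0 ≤ (dirForm c 0 s a).re :=
  (Complex.nonneg_iff.1 (hc s a)).1

theorem zero_re_nonneg (hc : PosSeq c) : 0 ≤ (c 0).re := by
  have := hc.re_nonneg {0} (fun _ => 1)
  simpa [dirForm] using this

/-- Nonnegativity of the Toeplitz form at `x a_k e_k + y w`, where `w` is the part of `a` supported
in `s ∌ k`; the value is written through the forms of `a` over `{k}`, `s` and `insert k s`. -/
theorem quadratic_nonneg (hc : PosSeq c) {s : Finset ℕ} {k : ℕ} (hk : k ∉ s) (a : ℕ → ℂ)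
    (x y : ℝ) :
    0 ≤ x ^ 2 * ((c 0).re * ‖a k‖ ^ 2) + x * y * ((dirForm c 0 (insert k s) a).re -
      (c 0).re * ‖a k‖ ^ 2 - (dirForm c 0 s a).re) + y ^ 2 * (dirForm c 0 s a).re := by
  have h := hc.re_nonneg (insert k s) (fun i => if i = k then x * a i else y * a i)
  rw [dirForm_zero_scale c hk, ← Complex.ofReal_pow, ← Complex.ofReal_pow, ← Complex.ofReal_mul]
    at h
  simp only [Complex.add_re, Complex.re_ofReal_mul, re_zero_mul_conj] at h
  simp only [dirForm_zero_insert c hk, Complex.add_re, re_zero_mul_conj]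
  linarith

theorem norm_sq_le (hc : PosSeq c) {s : Finset ℕ} {k : ℕ} (hk : k ∉ s) (a : ℕ → ℂ) :
    (c 0).re * ‖a k‖ ^ 2 ≤
      2 * (dirForm c 0 (insert k s) a).re + 2 * (dirForm c 0 s a).re := by
  linarith [hc.quadratic_nonneg hk a 1 2]

theorem le_insert (hc : PosSeq c) {s : Finset ℕ} {k : ℕ} (hk : k ∉ s) (a : ℕ → ℂ) :
    (dirForm c 0 s a).re ≤
      2 * (dirForm c 0 (insert k s) a).re + 2 * ((c 0).re * ‖a k‖ ^ 2) := by
  linarith [hc.quadratic_nonneg hk a 2 1]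

theorem insert_le (hc : PosSeq c) {s : Finset ℕ} {k : ℕ} (hk : k ∉ s) (a : ℕ → ℂ) :
    (dirForm c 0 (insert k s) a).re ≤
      2 * (dirForm c 0 s a).re + 2 * ((c 0).re * ‖a k‖ ^ 2) := by
  linarith [hc.quadratic_nonneg hk a 1 (-1)]

end PosSeq

theorem Ico_eq_insert {k N : ℕ} (h : k < N) : Ico k N = insert k (Ico (k + 1) N) := by
  ext i; simp only [mem_Ico, mem_insert]; omega

theorem sum_range_choose_eq (n M : ℕ) :
    ∑ k ∈ range M, k.choose n = M.choose (n + 1) := by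
  induction M with
  | zero => simp
  | succ M ih => rw [sum_range_succ, ih, Nat.choose_succ_succ, add_comm]

/-- A Dirichlet form of order `n + 1` is a positive combination of Toeplitz forms of the tails of
the sequence, by the hockey-stick identity `∑_{k < M} C(k, n) = C(M, n + 1)`. -/
theorem dirForm_succ (c : ℤ → ℂ) (n N : ℕ) (a : ℕ → ℂ) :
    dirForm c (n + 1) (range N) a =
      ∑ k ∈ range N, (k.choose n : ℂ) * dirForm c 0 (Ico (k + 1) N) a := by
  have h1 : ∀ k, dirForm c 0 (Ico (k + 1) N) a = ∑ i ∈ range N, ∑ j ∈ range N,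
      if k < min i j then c ((j : ℤ) - i) * (a i * conj (a j)) else 0 := by
    intro k
    have hI : Ico (k + 1) N = (range N).filter (fun i => k < i) := by
      ext i; simp only [mem_Ico, mem_filter, mem_range]; omega
    simp only [dirForm, hI, sum_filter, Nat.choose_zero_right, Nat.cast_one, one_mul]
    refine sum_congr rfl fun i _ => ?_
    by_cases hi : k < i
    · simp [hi]
    · simp [hi]
  simp only [h1, mul_sum]
  rw [sum_comm]
  refine sum_congr rfl fun i hi => ?_
  rw [sum_comm]
  refine sum_congr rfl fun j hj => ?_
  have h2 : ∑ k ∈ range N, (k.choose n : ℂ) *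
      (if k < min i j then c ((j : ℤ) - i) * (a i * conj (a j)) else 0) =
      (∑ k ∈ range (min i j), (k.choose n : ℂ)) * (c ((j : ℤ) - i) * (a i * conj (a j))) := by
    have hr : range (min i j) = (range N).filter (fun k => k < min i j) := by
      ext k; simp only [mem_filter, mem_range] at *; omega
    rw [hr, sum_filter, sum_mul]
    refine sum_congr rfl fun k _ => ?_
    split_ifs <;> simp
  rw [h2, ← sum_range_choose_eq]
  push_cast
  ring

theorem dirForm_succ_re (c : ℤ → ℂ) (n N : ℕ) (a : ℕ → ℂ) :
    (dirForm c (n + 1) (range N) a).re =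
      ∑ k ∈ range N, (k.choose n : ℝ) * (dirForm c 0 (Ico (k + 1) N) a).re := by
  rw [dirForm_succ, Complex.re_sum]
  refine sum_congr rfl fun k _ => ?_
  rw [← Complex.ofReal_natCast, Complex.re_ofReal_mul]

namespace PosSeq

variable {c : ℤ → ℂ}

theorem succ_re_nonneg (hc : PosSeq c) (n N : ℕ) (a : ℕ → ℂ) :
    0 ≤ (dirForm c (n + 1) (range N) a).re := by
  rw [dirForm_succ_re]
  exact sum_nonneg fun k _ => mul_nonneg (by positivity) (hc.re_nonneg _ _)

/-- The form of order `p + 1` of a positive definite sequence dominates a Sobolev sum of order `p`: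
`c(0) |a_k|²` is at most twice the sum of the Toeplitz forms of the tails from `k` and from `k + 1`,
and in `dirForm_succ` these have the weights `C(k - 1, p)` and `C(k, p) ≥ C(k - 1, p)`. -/
theorem sum_choose_norm_sq_le (hc : PosSeq c) {p : ℕ} (hp : p ≠ 0) (N : ℕ) (a : ℕ → ℂ) :
    (c 0).re * ∑ k ∈ range N, ((k - 1).choose p : ℝ) * ‖a k‖ ^ 2 ≤
      4 * (dirForm c (p + 1) (range N) a).re := by
  set q : ℕ → ℝ := fun k => (dirForm c 0 (Ico k N) a).re with hq
  have hq0 : ∀ k, 0 ≤ q k := fun k => hc.re_nonneg _ _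
  rw [dirForm_succ_re]
  change _ ≤ 4 * ∑ k ∈ range N, (k.choose p : ℝ) * q (k + 1)
  have h1 : ∑ k ∈ range N, ((k - 1).choose p : ℝ) * q k ≤
      ∑ k ∈ range N, (k.choose p : ℝ) * q (k + 1) := by
    rcases N with _ | M
    · simp
    · rw [sum_range_succ' (fun k => ((k - 1).choose p : ℝ) * q k), sum_range_succ]
      simp only [Nat.add_sub_cancel, Nat.zero_sub]
      rw [Nat.choose_eq_zero_of_lt (Nat.pos_of_ne_zero hp)]
      have : 0 ≤ (M.choose p : ℝ) * q (M + 1) := mul_nonneg (by positivity) (hq0 _)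
      simpa using this
  have h2 : ∑ k ∈ range N, ((k - 1).choose p : ℝ) * q (k + 1) ≤
      ∑ k ∈ range N, (k.choose p : ℝ) * q (k + 1) := by
    refine sum_le_sum fun k _ => mul_le_mul_of_nonneg_right ?_ (hq0 _)
    exact_mod_cast Nat.choose_le_choose p (Nat.sub_le k 1)
  have h3 : (c 0).re * ∑ k ∈ range N, ((k - 1).choose p : ℝ) * ‖a k‖ ^ 2 ≤
      ∑ k ∈ range N, (2 * (((k - 1).choose p : ℝ) * q k) +
        2 * (((k - 1).choose p : ℝ) * q (k + 1))) := by
    rw [mul_sum]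
    refine sum_le_sum fun k hk => ?_
    have h := hc.norm_sq_le (k := k) (s := Ico (k + 1) N) (by simp) a
    rw [← Ico_eq_insert (mem_range.1 hk)] at h
    have := mul_le_mul_of_nonneg_left h (Nat.cast_nonneg (α := ℝ) ((k - 1).choose p))
    simp only [hq]
    linarith
  rw [sum_add_distrib, ← mul_sum, ← mul_sum] at h3
  linarith

/-- Lowering the order by one. In `dirForm_succ` the weights satisfy `C(k, p) ≤ (p + 1) C(k, p + 1)`
except at `k = p`, and the tail from `p + 1` is compared with the tail from `p + 2`. -/
theorem dirForm_re_le_succ (hc : PosSeq c) (p N : ℕ) (hN : p + 1 < N) (a : ℕ → ℂ) :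
    (dirForm c (p + 1) (range N) a).re ≤
      (p + 3) * (dirForm c (p + 2) (range N) a).re + 2 * ((c 0).re * ‖a (p + 1)‖ ^ 2) := by
  set q : ℕ → ℝ := fun k => (dirForm c 0 (Ico k N) a).re
  have hq0 : ∀ k, 0 ≤ q k := fun k => hc.re_nonneg _ _
  rw [dirForm_succ_re, dirForm_succ_re]
  change ∑ k ∈ range N, (k.choose p : ℝ) * q (k + 1) ≤
    (p + 3) * ∑ k ∈ range N, (k.choose (p + 1) : ℝ) * q (k + 1) + _
  have h1 : q (p + 1) ≤ 2 * q (p + 2) + 2 * ((c 0).re * ‖a (p + 1)‖ ^ 2) := by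
    have h := hc.insert_le (k := p + 1) (s := Ico (p + 2) N) (by simp) a
    rwa [← Ico_eq_insert hN] at h
  have h2 : q (p + 2) ≤ ∑ k ∈ range N, (k.choose (p + 1) : ℝ) * q (k + 1) := by
    have := single_le_sum (f := fun k => (k.choose (p + 1) : ℝ) * q (k + 1))
      (fun k _ => mul_nonneg (by positivity) (hq0 _)) (mem_range.2 hN)
    simpa using this
  have h3 : ∀ k, (k.choose p : ℝ) * q (k + 1) ≤
      (p + 1) * ((k.choose (p + 1) : ℝ) * q (k + 1)) + if k = p then q (p + 1) else 0 := by
    intro k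
    rcases lt_trichotomy k p with h | rfl | h
    · simp [Nat.choose_eq_zero_of_lt h, Nat.choose_eq_zero_of_lt (h.trans (Nat.lt_succ_self p)),
        h.ne]
    · simp
    · have h4 : k.choose p ≤ (p + 1) * k.choose (p + 1) := by
        rw [mul_comm, Nat.choose_succ_right_eq]
        exact Nat.le_mul_of_pos_right _ (by omega)
      have h5 : (k.choose p : ℝ) ≤ (p + 1) * k.choose (p + 1) := by exact_mod_cast h4
      rw [if_neg h.ne', add_zero, ← mul_assoc]
      exact mul_le_mul_of_nonneg_right h5 (hq0 _)
  have h4 := sum_le_sum fun k (_ : k ∈ range N) => h3 k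
  rw [sum_add_distrib, ← mul_sum, sum_ite_eq' (range N) p, if_pos (by simp; omega)] at h4
  nlinarith

end PosSeq

/-! ### The Sobolev bound for forms with coefficients of moderate growth -/

/-- A discrete Hardy inequality: the kernel `1 / (1 + max(i, j))` is bounded by `4` on `ℓ²`. The
second term on the left makes the induction on `N` close. -/
theorem hardy_max (A : ℕ → ℝ) (N : ℕ) :
    ∑ i ∈ range N, ∑ j ∈ range N, A i * A j / (1 + max (i : ℝ) j) +
      (∑ i ∈ range N, A i) ^ 2 / N ≤ 4 * ∑ i ∈ range N, A i ^ 2 := by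
  induction N with
  | zero => simp
  | succ N ih =>
    have e : ∑ i ∈ range (N + 1), ∑ j ∈ range (N + 1), A i * A j / (1 + max (i : ℝ) j) =
        ∑ i ∈ range N, ∑ j ∈ range N, A i * A j / (1 + max (i : ℝ) j) +
          (2 * A N * (∑ i ∈ range N, A i) + A N ^ 2) / (1 + N) := by
      have h1 : ∀ i ∈ range N, max (i : ℝ) N = N := fun i hi =>
        max_eq_right (by exact_mod_cast (mem_range.1 hi).le)
      have h2 : ∀ i ∈ range N, max (N : ℝ) i = N := fun i hi =>
        max_eq_left (by exact_mod_cast (mem_range.1 hi).le)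
      have h3 : ∑ i ∈ range N, A i * A N / (1 + max (i : ℝ) N) =
          A N * (∑ i ∈ range N, A i) / (1 + N) := by
        rw [mul_sum, sum_div]
        exact sum_congr rfl fun i hi => by rw [h1 i hi, mul_comm]
      have h4 : ∑ i ∈ range N, A N * A i / (1 + max (N : ℝ) i) =
          A N * (∑ i ∈ range N, A i) / (1 + N) := by
        rw [mul_sum, sum_div]
        exact sum_congr rfl fun i hi => by rw [h2 i hi]
      simp only [sum_range_succ, sum_add_distrib, h3, h4, max_self]
      ring
    rw [e, sum_range_succ, sum_range_succ]
    set S := ∑ i ∈ range N, A i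
    set T := ∑ i ∈ range N, ∑ j ∈ range N, A i * A j / (1 + max (i : ℝ) j)
    rcases Nat.eq_zero_or_pos N with h0 | h0
    · subst h0
      simp at ih ⊢
      have hS : S = 0 := by simp [S]
      rw [hS]
      nlinarith [sq_nonneg (A 0)]
    · have hN : (0 : ℝ) < N := by exact_mod_cast h0
      -- Completing the square in `S`.
      have key : 4 * A N ^ 2 - (2 * A N * S + A N ^ 2) / (1 + N) -
          (S + A N) ^ 2 / ((N + 1 : ℕ) : ℝ) + S ^ 2 / N =
          ((S - 2 * N * A N) ^ 2 + 2 * N * A N ^ 2) / (N * (N + 1)) := by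
        push_cast
        field_simp
        ring
      have : 0 ≤ ((S - 2 * N * A N) ^ 2 + 2 * N * A N ^ 2) / (N * (N + 1)) := by positivity
      linarith

/-- The truncated Sobolev sum `∑_{k < N} (1 + k)^p |a_k|²`. -/
noncomputable def sobolev (p N : ℕ) (a : ℕ → ℂ) : ℝ :=
  ∑ k ∈ range N, (1 + (k : ℝ)) ^ p * ‖a k‖ ^ 2

theorem sobolev_nonneg (p N : ℕ) (a : ℕ → ℂ) : 0 ≤ sobolev p N a :=
  sum_nonneg fun _ _ => by positivity

/-- If `|c(j)|` grows like `(1 + |j|)^{t/2}`, the form of order `n' ≤ n` is bounded by the Sobolev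
sum of order `p`. The exponents are such that `x ^ (2n) y ^ (t + 2) ≤ x ^ p y ^ p` for
`1 ≤ x ≤ y`, which at `x = 1 + min(i, j)` and `y = 1 + max(i, j)` reduces the kernel to
`hardy_max`. -/
theorem norm_dirForm_le {c : ℤ → ℂ} {K : ℝ} {n n' t p : ℕ} (hK : 0 ≤ K)
    (hc : ∀ j : ℤ, ‖c j‖ ^ 2 ≤ K ^ 2 * (1 + |(j : ℝ)|) ^ t) (hn : n' ≤ n)
    (hp : (2 * n ≤ p ∧ t + 2 ≤ p) ∨ (p ≤ 2 * n ∧ 2 * n + t + 2 ≤ 2 * p)) (N : ℕ) (a : ℕ → ℂ) :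
    ‖dirForm c n' (range N) a‖ ≤ 4 * K * sobolev p N a := by
  set A : ℕ → ℝ := fun i => Real.sqrt ((1 + (i : ℝ)) ^ p) * ‖a i‖ with hA
  have hA2 : ∑ i ∈ range N, A i ^ 2 = sobolev p N a := by
    refine sum_congr rfl fun i _ => ?_
    rw [hA]; dsimp only
    rw [mul_pow, Real.sq_sqrt (by positivity)]
  have hxy : ∀ x y : ℝ, 1 ≤ x → x ≤ y → x ^ (2 * n) * y ^ (t + 2) ≤ x ^ p * y ^ p := by
    intro x y hx hxy
    have hy : 1 ≤ y := hx.trans hxy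
    rcases hp with ⟨h1, h2⟩ | ⟨h1, h2⟩
    · gcongr
    · obtain ⟨d, hd⟩ := Nat.exists_eq_add_of_le h1
      have h3 : d + (t + 2) ≤ p := by omega
      calc x ^ (2 * n) * y ^ (t + 2) = x ^ p * (x ^ d * y ^ (t + 2)) := by rw [hd]; ring
        _ ≤ x ^ p * (y ^ d * y ^ (t + 2)) := by gcongr
        _ = x ^ p * y ^ (d + (t + 2)) := by rw [pow_add y d]
        _ ≤ x ^ p * y ^ p := by gcongr
  have hterm : ∀ i j : ℕ, ‖((min i j).choose n' : ℂ) * c ((j : ℤ) - i) * (a i * conj (a j))‖ ≤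
      K * (A i * A j / (1 + max (i : ℝ) j)) := by
    intro i j
    have hx : (1 : ℝ) ≤ 1 + min (i : ℝ) j := by simp
    have hle : 1 + min (i : ℝ) j ≤ 1 + max (i : ℝ) j := by gcongr; exact min_le_max
    have hchoose : (((min i j).choose n' : ℕ) : ℝ) ≤ (1 + min (i : ℝ) j) ^ n := by
      calc (((min i j).choose n' : ℕ) : ℝ) ≤ ((min i j : ℕ) : ℝ) ^ n' := by
            exact_mod_cast Nat.choose_le_pow _ _
        _ ≤ (1 + min (i : ℝ) j) ^ n' := by gcongr; push_cast; linarith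
        _ ≤ (1 + min (i : ℝ) j) ^ n := pow_le_pow_right₀ hx hn
    have habs : |(((j : ℤ) - i : ℤ) : ℝ)| ≤ max (i : ℝ) j := by
      push_cast
      rw [abs_le]
      constructor <;> linarith [le_max_left (i : ℝ) j, le_max_right (i : ℝ) j,
        Nat.cast_nonneg (α := ℝ) i, Nat.cast_nonneg (α := ℝ) j]
    have hprod : (1 + min (i : ℝ) j) ^ p * (1 + max (i : ℝ) j) ^ p =
        (1 + (i : ℝ)) ^ p * (1 + (j : ℝ)) ^ p := by
      rcases le_total (i : ℝ) j with h | h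
      · rw [min_eq_left h, max_eq_right h]
      · rw [min_eq_right h, max_eq_left h, mul_comm]
    have hsq : ((((min i j).choose n' : ℕ) : ℝ) * ‖c ((j : ℤ) - i)‖ * (1 + max (i : ℝ) j)) ^ 2 ≤
        K ^ 2 * ((1 + (i : ℝ)) ^ p * (1 + (j : ℝ)) ^ p) := by
      have hc' : ‖c ((j : ℤ) - i)‖ ^ 2 ≤ K ^ 2 * (1 + max (i : ℝ) j) ^ t :=
        (hc _).trans (by gcongr)
      calc _ = (((min i j).choose n' : ℕ) : ℝ) ^ 2 * ‖c ((j : ℤ) - i)‖ ^ 2 *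
            (1 + max (i : ℝ) j) ^ 2 := by ring
        _ ≤ ((1 + min (i : ℝ) j) ^ n) ^ 2 * (K ^ 2 * (1 + max (i : ℝ) j) ^ t) *
            (1 + max (i : ℝ) j) ^ 2 := by gcongr
        _ = K ^ 2 * ((1 + min (i : ℝ) j) ^ (2 * n) * (1 + max (i : ℝ) j) ^ (t + 2)) := by ring
        _ ≤ K ^ 2 * ((1 + min (i : ℝ) j) ^ p * (1 + max (i : ℝ) j) ^ p) := by
            exact mul_le_mul_of_nonneg_left (hxy _ _ hx hle) (sq_nonneg K)
        _ = _ := by rw [hprod]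
    have hmul : (((min i j).choose n' : ℕ) : ℝ) * ‖c ((j : ℤ) - i)‖ * (1 + max (i : ℝ) j) ≤
        K * (Real.sqrt ((1 + (i : ℝ)) ^ p) * Real.sqrt ((1 + (j : ℝ)) ^ p)) := by
      refine abs_le_of_sq_le_sq' ?_ (by positivity) |>.2
      rw [mul_pow K, mul_pow (Real.sqrt _), Real.sq_sqrt (by positivity),
        Real.sq_sqrt (by positivity)]
      exact hsq
    have hpos : 0 < 1 + max (i : ℝ) j := by linarith
    rw [norm_mul, norm_mul, norm_mul, Complex.norm_natCast, RCLike.norm_conj, mul_div_assoc',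
      le_div_iff₀ hpos]
    calc _ = (((min i j).choose n' : ℕ) : ℝ) * ‖c ((j : ℤ) - i)‖ * (1 + max (i : ℝ) j) *
          (‖a i‖ * ‖a j‖) := by ring
      _ ≤ _ := mul_le_mul_of_nonneg_right hmul (by positivity)
      _ = _ := by rw [hA]; ring
  have h := hardy_max A N
  have h0 : 0 ≤ (∑ i ∈ range N, A i) ^ 2 / N := by positivity
  calc ‖dirForm c n' (range N) a‖
      ≤ ∑ i ∈ range N, ∑ j ∈ range N, K * (A i * A j / (1 + max (i : ℝ) j)) :=
        (norm_sum_le _ _).trans (sum_le_sum fun i _ =>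
          (norm_sum_le _ _).trans (sum_le_sum fun j _ => hterm i j))
    _ = K * ∑ i ∈ range N, ∑ j ∈ range N, A i * A j / (1 + max (i : ℝ) j) := by
        simp only [mul_sum]
    _ ≤ K * (4 * sobolev p N a) := by gcongr; linarith
    _ = _ := by ring

/-! ### Coercivity -/

/-- If a positive definite Toeplitz form controls the coefficient `a_0`, it controls each `a_k`:
as the form is translation invariant, its value on the tail from `k` controls `a_k`, and subtracting
the term `a_k` passes to the tail from `k + 1`. -/
theorem PosSeq.exists_norm_sq_le {c : ℤ → ℂ} (hc : PosSeq c)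
    (h0 : ∃ K : ℝ, 0 < K ∧ ∀ (N : ℕ) (a : ℕ → ℂ), 0 < N →
      ‖a 0‖ ^ 2 ≤ K * (dirForm c 0 (range N) a).re) (k : ℕ) :
    ∃ K : ℝ, 0 < K ∧ ∀ (N : ℕ) (a : ℕ → ℂ), k < N →
      ‖a k‖ ^ 2 ≤ K * (dirForm c 0 (range N) a).re := by
  obtain ⟨K, hK, h0⟩ := h0
  have hshift : ∀ (k N : ℕ) (a : ℕ → ℂ), k < N → ‖a k‖ ^ 2 ≤ K * (dirForm c 0 (Ico k N) a).re := by
    intro k N a hk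
    refine (h0 (N - k) (fun i => a (k + i)) (by omega)).trans (le_of_eq ?_)
    simp [dirForm, sum_Ico_eq_sum_range]
  have hc0 := hc.zero_re_nonneg
  have hq : ∀ k, ∃ M : ℝ, 0 < M ∧ ∀ N a,
      (dirForm c 0 (Ico k N) a).re ≤ M * (dirForm c 0 (range N) a).re := by
    intro k
    induction k with
    | zero => exact ⟨1, one_pos, fun N a => by rw [one_mul, range_eq_Ico]⟩
    | succ k ih =>
      obtain ⟨M, hM, ih⟩ := ih
      refine ⟨(2 + 2 * ((c 0).re * K)) * M, by positivity, fun N a => ?_⟩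
      rcases lt_or_ge k N with hk | hk
      · have h1 := hc.le_insert (k := k) (s := Ico (k + 1) N) (by simp) a
        rw [← Ico_eq_insert hk] at h1
        calc _ ≤ _ := h1
          _ ≤ 2 * (dirForm c 0 (Ico k N) a).re +
              2 * ((c 0).re * (K * (dirForm c 0 (Ico k N) a).re)) := by
              gcongr; exact hshift k N a hk
          _ = (2 + 2 * ((c 0).re * K)) * (dirForm c 0 (Ico k N) a).re := by ring
          _ ≤ (2 + 2 * ((c 0).re * K)) * (M * (dirForm c 0 (range N) a).re) := by
              gcongr; exact ih N a
          _ = _ := by ring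
      · rw [Ico_eq_empty_of_le (by omega)]
        have := hc.re_nonneg (range N) a
        simp only [dirForm, sum_empty, Complex.zero_re] at *
        positivity
  obtain ⟨M, hM, hq⟩ := hq k
  refine ⟨K * M, by positivity, fun N a hk => (hshift k N a hk).trans ?_⟩
  rw [mul_assoc]
  gcongr
  exact hq N a

theorem one_add_pow_le_choose {p k : ℕ} (hk : p + 1 ≤ k) :
    (1 + (k : ℝ)) ^ p ≤ (p + 2) ^ p * p.factorial * ((k - 1).choose p : ℝ) := by
  obtain ⟨d, rfl⟩ := Nat.exists_eq_add_of_le hk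
  have h1 := Nat.pow_le_choose (α := ℝ) p (p + 1 + d - 1)
  have e : p + 1 + d - 1 + 1 - p = d + 1 := by omega
  rw [e, div_le_iff₀ (by positivity)] at h1
  push_cast at h1 ⊢
  calc (1 + ((p : ℝ) + 1 + d)) ^ p ≤ ((p + 2) * (d + 1)) ^ p := by
        gcongr
        nlinarith [Nat.cast_nonneg (α := ℝ) p, Nat.cast_nonneg (α := ℝ) d,
          mul_nonneg (Nat.cast_nonneg (α := ℝ) p) (Nat.cast_nonneg (α := ℝ) d)]
    _ = (p + 2) ^ p * ((d : ℝ) + 1) ^ p := mul_pow _ _ _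
    _ ≤ (p + 2) ^ p * (((p + 1 + d - 1).choose p : ℝ) * p.factorial) := by gcongr
    _ = _ := by ring

/-- The Toeplitz form of `c` and the form of order `p + 1` of `d` together dominate the Sobolev sum
of order `p`: the first takes care of the coefficients `a_k` with `k ≤ p`, the second of the
others. -/
theorem exists_sobolev_le {c d : ℤ → ℂ} (hc : PosSeq c) (hd : PosSeq d) (hd0 : 0 < (d 0).re)
    (h0 : ∃ K : ℝ, 0 < K ∧ ∀ (N : ℕ) (a : ℕ → ℂ), 0 < N →
      ‖a 0‖ ^ 2 ≤ K * (dirForm c 0 (range N) a).re)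
    {p : ℕ} (hp : p ≠ 0) :
    ∃ K : ℝ, 0 < K ∧ ∀ (N : ℕ) (a : ℕ → ℂ), p < N → sobolev p N a ≤
      K * ((dirForm c 0 (range N) a).re + (dirForm d (p + 1) (range N) a).re) := by
  choose K hK hKa using hc.exists_norm_sq_le h0
  set M : ℝ := (p + 2) ^ p * p.factorial with hM
  have hM0 : 0 < M := by positivity
  set L : ℝ := (1 + p) ^ p * ∑ k ∈ range (p + 1), K k with hL
  have hL0 : 0 ≤ L := mul_nonneg (by positivity) (sum_nonneg fun k _ => (hK k).le)
  refine ⟨M * 4 / (d 0).re + L, by positivity, fun N a hN => ?_⟩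
  have hq := hc.re_nonneg (range N) a
  have hR := hd.succ_re_nonneg p N a
  have h1 : ∀ k : ℕ, (1 + (k : ℝ)) ^ p * ‖a k‖ ^ 2 ≤ M * (((k - 1).choose p : ℝ) * ‖a k‖ ^ 2) +
      (1 + p) ^ p * if k < p + 1 then ‖a k‖ ^ 2 else 0 := by
    intro k
    split_ifs with h
    · have : (1 + (k : ℝ)) ^ p ≤ (1 + p) ^ p := by
        gcongr; omega
      have h2 := mul_le_mul_of_nonneg_right this (sq_nonneg ‖a k‖)
      have h3 : 0 ≤ M * (((k - 1).choose p : ℝ) * ‖a k‖ ^ 2) := by positivity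
      linarith
    · have := mul_le_mul_of_nonneg_right (one_add_pow_le_choose (p := p) (k := k) (by omega))
        (sq_nonneg ‖a k‖)
      rw [hM]; linarith
  have h2 : sobolev p N a ≤ M * ∑ k ∈ range N, ((k - 1).choose p : ℝ) * ‖a k‖ ^ 2 +
      (1 + p) ^ p * ∑ k ∈ range (p + 1), ‖a k‖ ^ 2 := by
    have h3 := sum_le_sum fun k (_ : k ∈ range N) => h1 k
    rw [sum_add_distrib, ← mul_sum, ← mul_sum, ← sum_filter] at h3
    have : (range N).filter (fun k => k < p + 1) = range (p + 1) := by
      ext k; simp only [mem_filter, mem_range]; omega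
    rwa [this] at h3
  have h3 : ∑ k ∈ range N, ((k - 1).choose p : ℝ) * ‖a k‖ ^ 2 ≤
      4 / (d 0).re * (dirForm d (p + 1) (range N) a).re := by
    rw [div_mul_eq_mul_div, le_div_iff₀ hd0, mul_comm]
    exact hd.sum_choose_norm_sq_le hp N a
  have h4 : ∑ k ∈ range (p + 1), ‖a k‖ ^ 2 ≤
      (∑ k ∈ range (p + 1), K k) * (dirForm c 0 (range N) a).re := by
    rw [sum_mul]
    exact sum_le_sum fun k hk => hKa k N a (by rw [mem_range] at hk; omega)
  calc sobolev p N a ≤ _ := h2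
    _ ≤ M * (4 / (d 0).re * (dirForm d (p + 1) (range N) a).re) +
        (1 + p) ^ p * ((∑ k ∈ range (p + 1), K k) * (dirForm c 0 (range N) a).re) := by gcongr
    _ = M * 4 / (d 0).re * (dirForm d (p + 1) (range N) a).re +
        L * (dirForm c 0 (range N) a).re := by rw [hL]; ring
    _ ≤ _ := by
        have : 0 ≤ M * 4 / (d 0).re * (dirForm c 0 (range N) a).re := by positivity
        have : 0 ≤ L * (dirForm d (p + 1) (range N) a).re := by positivity
        linarith

/-- The two inequalities behind allowability, for finite sections. Here `v` and `c n` stand for the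
Fourier coefficients of `ν` and `μ_n`, and `p = m - 2`; the first sum is the form of the tuple, the
second is the increment of that form under multiplication by `z`. -/
theorem exists_allowable_bounds {p : ℕ} (hp : 1 < p) {v : ℤ → ℂ} (hv : PosSeq v)
    (h0 : ∃ K : ℝ, 0 < K ∧ ∀ (N : ℕ) (a : ℕ → ℂ), 0 < N →
      ‖a 0‖ ^ 2 ≤ K * (dirForm v 0 (range N) a).re)
    {c : ℕ → ℤ → ℂ}
    (hlow : ∀ n < p, ∃ K : ℝ, ∃ t : ℕ, 0 ≤ K ∧
      (∀ j : ℤ, ‖c n j‖ ^ 2 ≤ K ^ 2 * (1 + |(j : ℝ)|) ^ t) ∧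
      ((2 * n ≤ p ∧ t + 2 ≤ p) ∨ (p ≤ 2 * n ∧ 2 * n + t + 2 ≤ 2 * p)))
    (hzero : c p = 0) (htop : PosSeq (c (p + 1))) (htop0 : 0 < (c (p + 1) 0).re) :
    ∃ C₀ : ℝ, 0 < C₀ ∧ ∀ C : ℝ, C₀ ≤ C → ∃ C₁ : ℝ, 0 < C₁ ∧
      ∀ (N : ℕ) (a : ℕ → ℂ), p < N →
        0 ≤ C * (dirForm v 0 (range N) a).re +
            ∑ n ∈ range (p + 2), (dirForm (c n) n (range N) a).re +
            C * (dirForm (c (p + 1)) (p + 1) (range N) a).re ∧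
        (∑ n ∈ range (p + 1), (dirForm (c (n + 1)) n (range N) a).re +
            C * (dirForm (c (p + 1)) p (range N) a).re) ≤
          C₁ * (C * (dirForm v 0 (range N) a).re +
            ∑ n ∈ range (p + 2), (dirForm (c n) n (range N) a).re +
            C * (dirForm (c (p + 1)) (p + 1) (range N) a).re) := by
  obtain ⟨KS, hKS, hS⟩ := exists_sobolev_le hv htop htop0 h0 (p := p) (by omega)
  obtain ⟨KP, hKP, hP⟩ := hv.exists_norm_sq_le h0 p
  choose! K t hK hb hcond using hlow
  set M : ℝ := (∑ n ∈ range p, 4 * K n) * KS with hM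
  have hM0 : 0 ≤ M := mul_nonneg (sum_nonneg fun n hn => by
    have := hK n (mem_range.1 hn); positivity) hKS.le
  set P : ℝ := p + 2 + 2 * ((c (p + 1) 0).re * KP) with hPdef
  have hP0 : 0 < P := by positivity
  refine ⟨M + 1, by positivity, fun C hC => ⟨2 * M + P + C * P + 1, ?_, fun N a hN => ?_⟩⟩
  · have : 0 < C := by linarith
    positivity
  have hC0 : 0 < C := by linarith
  set V := (dirForm v 0 (range N) a).re
  set R := (dirForm (c (p + 1)) (p + 1) (range N) a).re with hR
  have hV0 : 0 ≤ V := hv.re_nonneg _ _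
  have hR0 : 0 ≤ R := htop.succ_re_nonneg _ _ _
  have hsob : sobolev p N a ≤ KS * (V + R) := hS N a hN
  have hmid : ∀ n' : ℕ → ℕ, (∀ n, n' n ≤ n) →
      |∑ n ∈ range p, (dirForm (c n) (n' n) (range N) a).re| ≤ M * (V + R) := by
    intro n' hn'
    calc |∑ n ∈ range p, (dirForm (c n) (n' n) (range N) a).re|
        ≤ ∑ n ∈ range p, 4 * K n * sobolev p N a :=
          (abs_sum_le_sum_abs _ _).trans (sum_le_sum fun n hn =>
            (Complex.abs_re_le_norm _).trans (by
              have hn := mem_range.1 hn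
              exact norm_dirForm_le (hK n hn) (hb n hn) (hn' n) (hcond n hn) N a))
      _ = (∑ n ∈ range p, 4 * K n) * sobolev p N a := by rw [sum_mul]
      _ ≤ (∑ n ∈ range p, 4 * K n) * (KS * (V + R)) := by
          gcongr
          exact sum_nonneg fun n hn => by have := hK n (mem_range.1 hn); positivity
      _ = M * (V + R) := by rw [hM]; ring
  have hlow : (dirForm (c (p + 1)) p (range N) a).re ≤ P * (V + R) := by
    obtain ⟨r, rfl⟩ : ∃ r, p = r + 1 := ⟨p - 1, by omega⟩
    have h1 := htop.dirForm_re_le_succ r N hN a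
    have h2 := hP N a hN
    have h3 : (c (r + 1 + 1) 0).re * ‖a (r + 1)‖ ^ 2 ≤ (c (r + 1 + 1) 0).re * (KP * V) := by
      gcongr
    have h4 : 0 ≤ (c (r + 1 + 1) 0).re * KP * R := by positivity
    have h5 : 0 ≤ ((r : ℝ) + 3) * V := by positivity
    rw [hPdef]
    push_cast
    change (dirForm (c (r + 1 + 1)) (r + 1) (range N) a).re ≤ (r + 3) * R + _ at h1
    linarith
  have hz : ∀ n, dirForm (c p) n (range N) a = 0 := fun n => by simp [dirForm, hzero]
  have h1 := abs_le.1 (hmid id fun n => le_rfl)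
  have h2 := abs_le.1 (hmid (fun n => n - 1) fun n => Nat.sub_le n 1)
  have e1 : ∑ n ∈ range (p + 2), (dirForm (c n) n (range N) a).re =
      ∑ n ∈ range p, (dirForm (c n) n (range N) a).re + R := by
    rw [sum_range_succ, sum_range_succ, hz]; simp [hR]
  have e2 : ∑ n ∈ range (p + 1), (dirForm (c (n + 1)) n (range N) a).re =
      ∑ n ∈ range p, (dirForm (c n) (n - 1) (range N) a).re -
        (dirForm (c 0) 0 (range N) a).re + (dirForm (c (p + 1)) p (range N) a).re := by
    rw [sum_range_succ]
    obtain ⟨r, rfl⟩ : ∃ r, p = r + 1 := ⟨p - 1, by omega⟩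
    rw [sum_range_succ, sum_range_succ' (fun n => (dirForm (c n) (n - 1) (range N) a).re), hz]
    simp
  have h3 : |(dirForm (c 0) 0 (range N) a).re| ≤ M * (V + R) := by
    have hp0 : 0 < p := by omega
    calc |(dirForm (c 0) 0 (range N) a).re| ≤ 4 * K 0 * sobolev p N a :=
          (Complex.abs_re_le_norm _).trans
            (norm_dirForm_le (hK 0 hp0) (hb 0 hp0) le_rfl (hcond 0 hp0) N a)
      _ ≤ (∑ n ∈ range p, 4 * K n) * (KS * (V + R)) := by
          have hle : 4 * K 0 ≤ ∑ n ∈ range p, 4 * K n :=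
            single_le_sum (f := fun n => 4 * K n)
              (fun n hn => by have := hK n (mem_range.1 hn); positivity) (mem_range.2 hp0)
          have := hK 0 hp0
          exact mul_le_mul hle hsob (sobolev_nonneg _ _ _) (by linarith)
      _ = M * (V + R) := by rw [hM]; ring
  have h3' := abs_le.1 h3
  -- The forms of order below `p` are absorbed by `C (V + R)` as soon as `C ≥ M + 1`.
  have hF : V + R ≤ C * V + ∑ n ∈ range (p + 2), (dirForm (c n) n (range N) a).re + C * R := by
    rw [e1]
    have : (M + 1) * (V + R) ≤ C * (V + R) := by gcongr
    have := h1.1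
    simp only [id] at this
    linarith
  have hVR : 0 ≤ V + R := by positivity
  refine ⟨hVR.trans hF, ?_⟩
  rw [e2]
  calc _ ≤ (2 * M + P + C * P + 1) * (V + R) := by
        have : C * (dirForm (c (p + 1)) p (range N) a).re ≤ C * (P * (V + R)) := by gcongr
        linarith [h2.2]
    _ ≤ _ := by
        gcongr

/-! ### Passage to infinite sequences -/

/-- The sequence `a` decays faster than every power. -/
def RapidDecay (a : ℕ → ℂ) : Prop :=
  ∀ N : ℕ, ∃ B : ℝ, ∀ k : ℕ, (1 + (k : ℝ)) ^ N * ‖a k‖ ≤ B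

/-- The sequence `c` on `ℤ` grows at most polynomially. -/
def PolyGrowth (c : ℤ → ℂ) : Prop :=
  ∃ N : ℕ, ∃ C : ℝ, 0 ≤ C ∧ ∀ k : ℤ, ‖c k‖ ≤ C * (1 + |(k : ℝ)|) ^ N

theorem RapidDecay.summable {a : ℕ → ℂ} (ha : RapidDecay a) (N : ℕ) :
    Summable fun k : ℕ => (1 + (k : ℝ)) ^ N * ‖a k‖ := by
  obtain ⟨B, hB⟩ := ha (N + 2)
  have h : Summable fun n : ℕ => ((1 + (n : ℝ)) ^ 2)⁻¹ := by
    have := (summable_nat_add_iff 1).2 (Real.summable_nat_pow_inv.2 one_lt_two)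
    simpa [add_comm] using this
  refine Summable.of_nonneg_of_le (fun k => by positivity) (fun k => ?_) (h.mul_left B)
  rw [← div_eq_mul_inv, le_div_iff₀ (by positivity)]
  calc _ = (1 + (k : ℝ)) ^ (N + 2) * ‖a k‖ := by ring
    _ ≤ B := hB k

theorem RapidDecay.summable_norm {a : ℕ → ℂ} (ha : RapidDecay a) : Summable fun k => ‖a k‖ := by
  simpa using ha.summable 0

theorem RapidDecay.mono {a b : ℕ → ℂ} (ha : RapidDecay a) (M : ℕ)
    (h : ∀ k : ℕ, ‖b k‖ ≤ (1 + (k : ℝ)) ^ M * ‖a k‖) : RapidDecay b := by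
  intro N
  obtain ⟨B, hB⟩ := ha (N + M)
  refine ⟨B, fun k => le_trans ?_ (hB k)⟩
  rw [pow_add, mul_assoc]
  gcongr
  exact h k

theorem RapidDecay.shift {a : ℕ → ℂ} (ha : RapidDecay a) : RapidDecay fun k => a (k + 1) := by
  intro N
  obtain ⟨B, hB⟩ := ha N
  refine ⟨B, fun k => le_trans ?_ (hB (k + 1))⟩
  gcongr
  simp

/-- The term with indices `q = (i, j)` of the double series
`∑_{i,j} C(min(i,j), n) c(j - i) a_i ā_j`. -/
noncomputable def formTerm (c : ℤ → ℂ) (n : ℕ) (a : ℕ → ℂ) (q : ℕ × ℕ) : ℂ :=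
  ((min q.1 q.2).choose n : ℂ) * c ((q.2 : ℤ) - q.1) * (a q.1 * conj (a q.2))

theorem PolyGrowth.norm_sub_le {c : ℤ → ℂ} (hc : PolyGrowth c) :
    ∃ N : ℕ, ∃ C : ℝ, 0 ≤ C ∧ ∀ i j : ℕ,
      ‖c ((j : ℤ) - i)‖ ≤ C * ((1 + (i : ℝ)) ^ N * (1 + (j : ℝ)) ^ N) := by
  obtain ⟨N, C, hC, h⟩ := hc
  refine ⟨N, C, hC, fun i j => (h _).trans ?_⟩
  rw [← mul_pow]
  have : |(((j : ℤ) - i : ℤ) : ℝ)| ≤ i + j := by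
    push_cast
    rw [abs_le]
    constructor <;> linarith [Nat.cast_nonneg (α := ℝ) i, Nat.cast_nonneg (α := ℝ) j]
  gcongr
  nlinarith [Nat.cast_nonneg (α := ℝ) i, Nat.cast_nonneg (α := ℝ) j,
    mul_nonneg (Nat.cast_nonneg (α := ℝ) i) (Nat.cast_nonneg (α := ℝ) j)]

theorem summable_norm_formTerm {c : ℤ → ℂ} (hc : PolyGrowth c) (n : ℕ) {a : ℕ → ℂ}
    (ha : RapidDecay a) : Summable fun q => ‖formTerm c n a q‖ := by
  obtain ⟨N, C, hC, h⟩ := hc.norm_sub_le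
  have hs := ((ha.summable (n + N)).mul_of_nonneg (ha.summable N)
    (fun _ => by positivity) (fun _ => by positivity)).mul_left C
  refine Summable.of_nonneg_of_le (fun _ => norm_nonneg _) (fun q => ?_) hs
  have hch : (((min q.1 q.2).choose n : ℕ) : ℝ) ≤ (1 + (q.1 : ℝ)) ^ n := by
    calc (((min q.1 q.2).choose n : ℕ) : ℝ) ≤ ((min q.1 q.2 : ℕ) : ℝ) ^ n := by
          exact_mod_cast Nat.choose_le_pow _ _
      _ ≤ (1 + (q.1 : ℝ)) ^ n := by
          gcongr
          have : ((min q.1 q.2 : ℕ) : ℝ) ≤ q.1 := by exact_mod_cast min_le_left _ _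
          linarith
  rw [formTerm, norm_mul, norm_mul, norm_mul, Complex.norm_natCast, RCLike.norm_conj]
  calc _ ≤ (1 + (q.1 : ℝ)) ^ n * (C * ((1 + (q.1 : ℝ)) ^ N * (1 + (q.2 : ℝ)) ^ N)) *
        (‖a q.1‖ * ‖a q.2‖) := by gcongr; exact h _ _
    _ = _ := by ring

theorem tendsto_dirForm {c : ℤ → ℂ} (hc : PolyGrowth c) (n : ℕ) {a : ℕ → ℂ}
    (ha : RapidDecay a) :
    Tendsto (fun N => dirForm c n (range N) a) atTop (𝓝 (∑' q, formTerm c n a q)) := by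
  have h := (summable_norm_formTerm hc n ha).of_norm.hasSum
  have ht : Tendsto (fun N : ℕ => range N ×ˢ range N) atTop atTop := by
    refine tendsto_atTop_finset_of_monotone (fun M N h => ?_) fun q => ?_
    · gcongr
    · exact ⟨max q.1 q.2 + 1, by simp only [mem_product, mem_range]; omega⟩
  refine (h.comp ht).congr fun N => ?_
  simp [dirForm, formTerm, sum_product]

/-! ### Circle means of `|g|² P_μ` -/

/-- The Poisson extension as one series over `ℤ`, and its absolute convergence. In each term at
least one of the truncated exponents `j.toNat` and `(-j).toNat` is zero. -/
theorem hasSum_poisson (μ : Distribution) {z : ℂ} (hz : ‖z‖ < 1) :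
    Summable (fun j : ℤ => ‖μ.hat j‖ * ‖z‖ ^ j.natAbs) ∧
    HasSum (fun j : ℤ => μ.hat j * (z ^ j.toNat * conj z ^ (-j).toNat)) (μ.poisson z) := by
  obtain ⟨N, C, hC, h⟩ := μ.exists_hat_bound
  have hs : Summable (fun j : ℤ => ‖μ.hat j‖ * ‖z‖ ^ j.natAbs) := by
    have h1 : Summable fun k : ℕ => C * ((1 + (k : ℝ)) ^ N * ‖z‖ ^ k) := by
      refine Summable.mul_left C ?_
      have h2 : Summable fun k : ℕ => (k : ℝ) ^ N * ‖z‖ ^ k :=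
        summable_pow_mul_geometric_of_norm_lt_one N (by simpa using hz)
      rcases eq_or_ne z 0 with rfl | h0
      · refine summable_of_ne_finset_zero (s := {0}) fun k hk => ?_
        simp at hk; simp [hk]
      · have h3 := ((summable_nat_add_iff 1).2 h2).mul_right (‖z‖⁻¹)
        refine h3.congr fun k => ?_
        have : ‖z‖ ≠ 0 := by simpa using h0
        push_cast
        field_simp
        ring
    refine Summable.of_nat_of_neg ?_ ?_
    · refine Summable.of_nonneg_of_le (fun k => by positivity) (fun k => ?_) h1
      have := h k
      simp only [Int.cast_natCast, Nat.abs_cast, Int.natAbs_natCast] at *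
      rw [← mul_assoc]
      gcongr
    · refine Summable.of_nonneg_of_le (fun k => by positivity) (fun k => ?_) h1
      have := h (-k)
      simp only [Int.cast_neg, abs_neg, Int.cast_natCast, Nat.abs_cast, Int.natAbs_neg,
        Int.natAbs_natCast] at *
      rw [← mul_assoc]
      gcongr
  refine ⟨hs, ?_⟩
  have hn : ∀ j : ℤ, ‖μ.hat j * (z ^ j.toNat * conj z ^ (-j).toNat)‖ =
      ‖μ.hat j‖ * ‖z‖ ^ j.natAbs := fun j => by
    rw [norm_mul, norm_mul, norm_pow, norm_pow, RCLike.norm_conj, ← pow_add]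
    congr 2; omega
  have hs' : Summable (fun j : ℤ => μ.hat j * (z ^ j.toNat * conj z ^ (-j).toNat)) :=
    Summable.of_norm (hs.congr fun j => (hn j).symm)
  have h1 := (hs'.comp_injective (i := fun k : ℕ => (k : ℤ)) Nat.cast_injective).hasSum
  have h2 := (hs'.comp_injective (i := fun k : ℕ => -((k : ℤ) + 1)) (fun a b h => by
    simp only at h; omega)).hasSum
  have := HasSum.of_nat_of_neg_add_one
    (f := fun j : ℤ => μ.hat j * (z ^ j.toNat * conj z ^ (-j).toNat)) h1 h2
  convert this using 1
  rw [Distribution.poisson]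
  congr 1
  · refine tsum_congr fun k => ?_
    simp
  · refine tsum_congr fun k => ?_
    have e1 : (-((k : ℤ) + 1)).toNat = 0 := by omega
    have e2 : (-(-((k : ℤ) + 1))).toNat = k + 1 := by omega
    simp only [Function.comp, e1, e2, pow_zero, one_mul]

/-- `f` is the sum of the power series `∑ a_k z^k` in the open unit disc. -/
def HasTaylor (a : ℕ → ℂ) (f : ℂ → ℂ) : Prop :=
  ∀ z : ℂ, ‖z‖ < 1 → HasSum (fun k : ℕ => a k * z ^ k) (f z)

theorem integral_exp_int (m : ℤ) :
    (2 * Real.pi : ℂ)⁻¹ * ∫ t in (0 : ℝ)..(2 * Real.pi), Complex.exp (m * Complex.I * t) =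
      if m = 0 then 1 else 0 := by
  have h := circleCoeff_monomial m 0
  rw [circleCoeff_eq] at h
  simp only [eq_comm (a := (0 : ℤ))] at h
  rw [← h]
  congr 2
  funext t
  change _ = (Circle.exp t : ℂ) ^ m * _
  rw [Circle.coe_exp, ← Complex.exp_int_mul]
  simp
  ring_nf

theorem circleAverage_monomial (r : ℝ) (k l : ℕ) (j : ℤ) :
    Real.circleAverage (fun z : ℂ => z ^ k * conj z ^ l * (z ^ j.toNat * conj z ^ (-j).toNat)) 0 r =
      if j = (l : ℤ) - k then (r : ℂ) ^ (2 * max k l) else 0 := by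
  have h1 : ∀ t : ℝ, (fun z : ℂ => z ^ k * conj z ^ l * (z ^ j.toNat * conj z ^ (-j).toNat))
      (circleMap 0 r t) = (r : ℂ) ^ (k + l + j.natAbs) *
        Complex.exp (((k - l + j : ℤ) : ℂ) * Complex.I * t) := by
    intro t
    have hj : ((j.toNat : ℤ) : ℂ) - ((-j).toNat : ℤ) = j := by
      exact_mod_cast Int.toNat_sub_toNat_neg j
    have e1 : circleMap 0 r t = r * Complex.exp (t * Complex.I) := by simp [circleMap]
    have e2 : conj (circleMap 0 r t) = r * Complex.exp (-(t * Complex.I)) := by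
      rw [e1, map_mul, Complex.conj_ofReal, ← Complex.exp_conj]
      simp
    have e3 : j.natAbs = j.toNat + (-j).toNat := by omega
    simp only [e1] at e2
    simp only [e1, e2, mul_pow, e3, ← Complex.exp_nat_mul]
    rw [show ((k - l + j : ℤ) : ℂ) * Complex.I * t =
      k * (t * Complex.I) + l * (-(t * Complex.I)) + (j.toNat * (t * Complex.I) +
        (-j).toNat * (-(t * Complex.I))) by
        push_cast; rw [← hj]; push_cast; ring]
    simp only [Complex.exp_add]
    ring
  rw [Real.circleAverage_def]
  simp only [h1]
  rw [intervalIntegral.integral_const_mul, Complex.real_smul]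
  have h2 := integral_exp_int (k - l + j)
  push_cast at h2 ⊢
  rw [mul_left_comm, h2]
  by_cases hj : j = (l : ℤ) - k
  · have hj' : (k : ℤ) - l + j = 0 := by omega
    rw [if_pos hj, if_pos hj', mul_one]
    congr 1
    omega
  · have hj' : ¬ (k : ℤ) - l + j = 0 := by omega
    rw [if_neg hj, if_neg hj', mul_zero]

theorem hasSum_mul_mul {ι κ τ : Type*} {f : ι → ℂ} {g : κ → ℂ} {h : τ → ℂ} {x y z : ℂ}
    (hf : HasSum f x) (hg : HasSum g y) (hh : HasSum h z) (nf : Summable fun i => ‖f i‖)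
    (ng : Summable fun i => ‖g i‖) (nh : Summable fun i => ‖h i‖) :
    HasSum (fun q : (ι × κ) × τ => f q.1.1 * g q.1.2 * h q.2) (x * y * z) := by
  have n : Summable fun q : ι × κ => ‖f q.1 * g q.2‖ := nf.mul_norm ng
  have h1 : HasSum (fun q : ι × κ => f q.1 * g q.2) (x * y) := hf.mul hg n.of_norm
  have n' : Summable fun q : (ι × κ) × τ => ‖f q.1.1 * g q.1.2 * h q.2‖ :=
    Summable.mul_norm (f := fun q : ι × κ => f q.1 * g q.2) n nh
  exact HasSum.mul (f := fun q : ι × κ => f q.1 * g q.2) h1 hh n'.of_norm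

/-- The mean of `|g|² P_μ` over the circle of radius `r` is the Toeplitz form of `μ̂` with weights
`r ^ (2 max(k, l))`: the mean of `z^k z̄^l z^j` (with `z^j` read as `z̄^{-j}` for `j < 0`) vanishes
unless `j = l - k`, and then `k + l + |j| = 2 max(k, l)`. -/
theorem hasSum_circleAverage (μ : Distribution) {b : ℕ → ℂ} (hb : RapidDecay b) {g : ℂ → ℂ}
    (hg : HasTaylor b g) {r : ℝ} (hr0 : 0 ≤ r) (hr1 : r < 1) :
    HasSum (fun q : ℕ × ℕ => formTerm μ.hat 0 b q * (r : ℂ) ^ (2 * max q.1 q.2))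
      (Real.circleAverage (fun z : ℂ => ((‖g z‖ ^ 2 : ℝ) : ℂ) * μ.poisson z) 0 r) := by
  have hnorm : ∀ t : ℝ, ‖circleMap 0 r t‖ = r := fun t => by simp [abs_of_nonneg hr0]
  set T : (ℕ × ℕ) × ℤ → ℂ → ℂ := fun q z => (b q.1.1 * conj (b q.1.2) * μ.hat q.2) *
    (z ^ q.1.1 * conj z ^ q.1.2 * (z ^ q.2.toNat * conj z ^ (-q.2).toNat)) with hT
  have hs1 : Summable fun k : ℕ => ‖b k‖ * r ^ k :=
    Summable.of_nonneg_of_le (fun k => by positivity)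
      (fun k => mul_le_of_le_one_right (norm_nonneg _) (pow_le_one₀ hr0 hr1.le)) hb.summable_norm
  have hs2 : Summable fun j : ℤ => ‖μ.hat j‖ * r ^ j.natAbs := by
    have := (hasSum_poisson μ (z := (r : ℂ)) (by simpa [abs_of_nonneg hr0] using hr1)).1
    simpa [abs_of_nonneg hr0] using this
  set bd : (ℕ × ℕ) × ℤ → ℝ := fun q =>
    (‖b q.1.1‖ * r ^ q.1.1) * (‖b q.1.2‖ * r ^ q.1.2) * (‖μ.hat q.2‖ * r ^ q.2.natAbs) with hbd
  have hbds : Summable bd :=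
    (hs1.mul_of_nonneg hs1 (fun _ => by positivity) (fun _ => by positivity)).mul_of_nonneg hs2
      (fun _ => by positivity) (fun _ => by positivity)
  have hTn : ∀ q z, ‖z‖ = r → ‖T q z‖ = bd q := by
    intro q z hz
    simp only [hT, hbd, norm_mul, norm_pow, RCLike.norm_conj, hz]
    have : q.2.natAbs = q.2.toNat + (-q.2).toNat := by omega
    rw [this]
    ring
  have hTs : ∀ z, ‖z‖ = r → HasSum (fun q => T q z) (((‖g z‖ ^ 2 : ℝ) : ℂ) * μ.poisson z) := by
    intro z hz
    have hz1 : ‖z‖ < 1 := hz ▸ hr1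
    have h1 := hg z hz1
    have h2 : HasSum (fun k : ℕ => conj (b k * z ^ k)) (conj (g z)) :=
      (Complex.hasSum_conj (f := fun k : ℕ => b k * z ^ k)).2 (by simpa using h1)
    have h3 := (hasSum_poisson μ hz1).2
    have n1 : Summable fun k : ℕ => ‖b k * z ^ k‖ := by
      simpa [norm_mul, norm_pow, hz] using hs1
    have n2 : Summable fun k : ℕ => ‖conj (b k * z ^ k)‖ := by
      simpa [norm_mul, norm_pow, hz] using hs1
    have n3 : Summable fun j : ℤ => ‖μ.hat j * (z ^ j.toNat * conj z ^ (-j).toNat)‖ := by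
      refine hs2.congr fun j => ?_
      have : j.natAbs = j.toNat + (-j).toNat := by omega
      rw [this, norm_mul, norm_mul, norm_pow, norm_pow, RCLike.norm_conj, hz, pow_add]
    have h4 := hasSum_mul_mul h1 h2 h3 n1 n2 n3
    rw [Complex.mul_conj, Complex.normSq_eq_norm_sq] at h4
    have e : (fun q => T q z) = fun q : (ℕ × ℕ) × ℤ => b q.1.1 * z ^ q.1.1 *
        conj (b q.1.2 * z ^ q.1.2) * (μ.hat q.2 * (z ^ q.2.toNat * conj z ^ (-q.2).toNat)) := by
      funext q
      simp only [hT, map_mul, map_pow]; ring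
    rw [e, Complex.ofReal_pow]
    exact_mod_cast h4
  have hcont : ∀ q, Continuous fun t : ℝ => T q (circleMap 0 r t) := fun q => by
    have : Continuous (T q) := by
      simp only [hT]
      fun_prop
    exact this.comp (continuous_circleMap 0 r)
  have hI := intervalIntegral.hasSum_integral_of_dominated_convergence (μ := volume)
    (a := 0) (b := 2 * Real.pi) (F := fun q t => T q (circleMap 0 r t))
    (f := fun t => ((‖g (circleMap 0 r t)‖ ^ 2 : ℝ) : ℂ) * μ.poisson (circleMap 0 r t))
    (fun q _ => bd q) (fun q => (hcont q).aestronglyMeasurable)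
    (fun q => .of_forall fun t _ => (hTn q _ (hnorm t)).le)
    (.of_forall fun t _ => hbds) (by simp)
    (.of_forall fun t _ => hTs _ (hnorm t))
  have hA : HasSum (fun q => Real.circleAverage (T q) 0 r)
      (Real.circleAverage (fun z : ℂ => ((‖g z‖ ^ 2 : ℝ) : ℂ) * μ.poisson z) 0 r) :=
    hI.const_smul _
  have hA' : ∀ q, Real.circleAverage (T q) 0 r = (b q.1.1 * conj (b q.1.2) * μ.hat q.2) *
      if q.2 = (q.1.2 : ℤ) - q.1.1 then (r : ℂ) ^ (2 * max q.1.1 q.1.2) else 0 := by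
    intro q
    rw [← circleAverage_monomial, ← smul_eq_mul, ← Real.circleAverage_fun_smul]
    simp [hT]
  simp only [hA'] at hA
  refine hA.prod_fiberwise fun q => ?_
  convert hasSum_ite_eq ((q.2 : ℤ) - q.1) (formTerm μ.hat 0 b q * (r : ℂ) ^ (2 * max q.1 q.2))
    using 2 with j
  split_ifs with h
  · dsimp only at h ⊢
    subst h
    simp only [formTerm, Nat.choose_zero_right, Nat.cast_one, one_mul]
    ring
  · simp

/-! ### Taylor coefficients of derivatives -/

theorem HasTaylor.hasTaylor_deriv {a : ℕ → ℂ} {f : ℂ → ℂ} (hf : HasTaylor a f) (ha : RapidDecay a) :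
    HasTaylor (fun k => ((k + 1 : ℕ) : ℂ) * a (k + 1)) (deriv f) := by
  intro z hz
  have hzU : z ∈ Metric.ball (0 : ℂ) 1 := by simpa using hz
  have h := Complex.hasSum_deriv_of_summable_norm (F := fun (k : ℕ) (w : ℂ) => a k * w ^ k)
    ha.summable_norm (fun k => by fun_prop) Metric.isOpen_ball (fun k w hw => by
      rw [norm_mul, norm_pow]
      exact mul_le_of_le_one_right (norm_nonneg _)
        (pow_le_one₀ (norm_nonneg _) (by simpa using (Metric.mem_ball.1 hw).le))) hzU
  have hd : deriv f z = deriv (fun w : ℂ => ∑' k : ℕ, a k * w ^ k) z := by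
    refine Filter.EventuallyEq.deriv_eq ?_
    filter_upwards [Metric.isOpen_ball.mem_nhds hzU] with w hw
    exact (hf w (by simpa using hw)).tsum_eq.symm
  rw [← hd] at h
  have h' := (hasSum_nat_add_iff' 1).2 h
  simp only [range_one, sum_singleton, pow_zero, deriv_const, sub_zero] at h'
  have e : ∀ k : ℕ, deriv (fun w : ℂ => a (k + 1) * w ^ (k + 1)) z =
      ((k + 1 : ℕ) : ℂ) * a (k + 1) * z ^ k := fun k => by
    rw [deriv_const_mul _ (by fun_prop)]
    simp
    ring
  simpa only [e] using h'

theorem RapidDecay.succ_mul {a : ℕ → ℂ} (ha : RapidDecay a) :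
    RapidDecay (fun k => ((k + 1 : ℕ) : ℂ) * a (k + 1)) :=
  ha.shift.mono 1 fun k => by
    rw [norm_mul, Complex.norm_natCast, pow_one]; push_cast; rw [add_comm]

/-- The Taylor coefficients `(k + n)! / k! · a_{k+n}` of the `n`-th derivative of `∑ a_k z^k`. -/
noncomputable def derivCoeff (a : ℕ → ℂ) (n k : ℕ) : ℂ :=
  ((k + n).descFactorial n : ℂ) * a (k + n)

theorem derivCoeff_succ (a : ℕ → ℂ) (n : ℕ) :
    derivCoeff a (n + 1) = fun k => ((k + 1 : ℕ) : ℂ) * derivCoeff a n (k + 1) := by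
  funext k
  have : (k + (n + 1)).descFactorial (n + 1) = (k + 1) * (k + 1 + n).descFactorial n := by
    rw [Nat.descFactorial_succ]
    congr 1
    · omega
    · congr 1; omega
  rw [derivCoeff, derivCoeff, this, show k + (n + 1) = k + 1 + n by omega]
  push_cast
  ring

theorem rapidDecay_derivCoeff {a : ℕ → ℂ} (ha : RapidDecay a) (n : ℕ) :
    RapidDecay (derivCoeff a n) := by
  induction n with
  | zero => simpa [derivCoeff, RapidDecay] using ha
  | succ n ih => rw [derivCoeff_succ]; exact ih.succ_mul

theorem HasTaylor.hasTaylor_iteratedDeriv {a : ℕ → ℂ} {f : ℂ → ℂ} (hf : HasTaylor a f)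
    (ha : RapidDecay a) (n : ℕ) : HasTaylor (derivCoeff a n) (iteratedDeriv n f) := by
  induction n with
  | zero => simpa [derivCoeff, HasTaylor] using hf
  | succ n ih =>
    rw [iteratedDeriv_succ, derivCoeff_succ]
    exact ih.hasTaylor_deriv (rapidDecay_derivCoeff ha n)

/-! ### The Dirichlet integrals as quadratic forms in the Taylor coefficients -/

theorem HasTaylor.continuousOn {a : ℕ → ℂ} {f : ℂ → ℂ} (hf : HasTaylor a f) (ha : RapidDecay a) :
    ContinuousOn f (Metric.ball 0 1) := by
  have h : ContinuousOn (fun z : ℂ => ∑' k : ℕ, a k * z ^ k) (Metric.ball 0 1) :=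
    continuousOn_tsum (fun k => by fun_prop) ha.summable_norm fun k z hz => by
      rw [norm_mul, norm_pow]
      exact mul_le_of_le_one_right (norm_nonneg _)
        (pow_le_one₀ (norm_nonneg _) (by simpa using (Metric.mem_ball.1 hz).le))
  exact h.congr fun z hz => (hf z (by simpa using hz)).tsum_eq.symm

theorem continuousOn_poisson (μ : Distribution) : ContinuousOn μ.poisson (Metric.ball 0 1) := by
  intro z hz
  have hz' : ‖z‖ < 1 := by simpa using hz
  obtain ⟨r, hzr, hr1⟩ := exists_between hz'
  have hr0 : 0 ≤ r := (norm_nonneg z).trans hzr.le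
  have hs := (hasSum_poisson μ (z := (r : ℂ)) (by simpa [abs_of_nonneg hr0] using hr1)).1
  have h : ContinuousOn (fun z : ℂ => ∑' j : ℤ, μ.hat j * (z ^ j.toNat * conj z ^ (-j).toNat))
      (Metric.ball 0 r) := by
    refine continuousOn_tsum (fun k => by fun_prop) hs fun j w hw => ?_
    have hw' : ‖w‖ ≤ r := by simpa using (Metric.mem_ball.1 hw).le
    rw [norm_mul, norm_mul, norm_pow, norm_pow, RCLike.norm_conj, ← pow_add]
    have : j.toNat + (-j).toNat = j.natAbs := by omega
    rw [this, Complex.norm_real, Real.norm_of_nonneg hr0]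
    gcongr
  have h' : ContinuousOn μ.poisson (Metric.ball 0 r) := h.congr fun w hw =>
    ((hasSum_poisson μ (by
      have : ‖w‖ < r := by simpa using hw
      linarith)).2.tsum_eq).symm
  exact (h'.continuousAt (Metric.isOpen_ball.mem_nhds (by simpa using hzr))).continuousWithinAt

/-- Integration over a disc in polar coordinates. -/
theorem integral_ball_eq {F : ℂ → ℂ} (hF : ContinuousOn F (Metric.ball 0 1)) {r : ℝ}
    (hr0 : 0 ≤ r) (hr1 : r < 1) :
    ∫ z in Metric.ball (0 : ℂ) r, F z =
      ∫ ρ in (0 : ℝ)..r, ((2 * Real.pi * ρ : ℝ) : ℂ) * Real.circleAverage F 0 ρ := by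
  have hpolar : ∀ p : ℝ × ℝ, Complex.polarCoord.symm p = circleMap 0 p.1 p.2 := fun p => by
    rw [Complex.polarCoord_symm_apply, circleMap, zero_add, Complex.exp_mul_I]
    push_cast; rfl
  rw [← integral_indicator Metric.isOpen_ball.measurableSet,
    ← Complex.integral_comp_polarCoord_symm]
  have hset : polarCoord.target ∩ (Set.Ioo 0 r ×ˢ Set.Ioo (-Real.pi) Real.pi) =
      Set.Ioo 0 r ×ˢ Set.Ioo (-Real.pi) Real.pi := by
    rw [polarCoord_target]
    ext p; simp; tauto
  have hcont : ContinuousOn (fun p : ℝ × ℝ => p.1 • F (circleMap 0 p.1 p.2))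
      (Set.Icc 0 r ×ˢ Set.Icc (-Real.pi) Real.pi) := by
    refine continuousOn_fst.smul (hF.comp (Continuous.continuousOn ?_) ?_)
    · unfold circleMap; fun_prop
    · rintro ⟨ρ, θ⟩ ⟨hρ, -⟩
      have : |ρ| < 1 := by rw [abs_of_nonneg hρ.1]; exact hρ.2.trans_lt hr1
      simpa using this
  have hint : IntegrableOn (fun p : ℝ × ℝ => p.1 • F (circleMap 0 p.1 p.2))
      (Set.Ioo 0 r ×ˢ Set.Ioo (-Real.pi) Real.pi) (volume.prod volume) := by
    refine IntegrableOn.mono_set ?_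
      (Set.prod_mono Set.Ioo_subset_Icc_self Set.Ioo_subset_Icc_self)
    exact hcont.integrableOn_compact (isCompact_Icc.prod isCompact_Icc)
  have h1 : ∫ p in polarCoord.target,
      p.1 • (Metric.ball (0 : ℂ) r).indicator F (Complex.polarCoord.symm p) =
      ∫ p in Set.Ioo 0 r ×ˢ Set.Ioo (-Real.pi) Real.pi, p.1 • F (circleMap 0 p.1 p.2) := by
    rw [← hset, ← setIntegral_indicator (measurableSet_Ioo.prod measurableSet_Ioo)]
    refine setIntegral_congr_fun polarCoord.open_target.measurableSet fun p hp => ?_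
    rw [polarCoord_target] at hp
    have hp0 : 0 < p.1 := hp.1
    by_cases hpr : p.1 < r
    · rw [Set.indicator_of_mem (show p ∈ Set.Ioo 0 r ×ˢ Set.Ioo (-Real.pi) Real.pi from
        ⟨⟨hp0, hpr⟩, hp.2⟩), Set.indicator_of_mem, hpolar]
      simpa [hpolar, abs_of_pos hp0] using hpr
    · rw [Set.indicator_of_notMem (show p ∉ Set.Ioo 0 r ×ˢ Set.Ioo (-Real.pi) Real.pi from
        fun h => hpr h.1.2), Set.indicator_of_notMem, smul_zero]
      simpa [hpolar, abs_of_pos hp0] using not_lt.1 hpr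
  rw [h1, Measure.volume_eq_prod, setIntegral_prod _ hint,
    intervalIntegral.integral_of_le hr0, integral_Ioc_eq_integral_Ioo]
  refine setIntegral_congr_fun measurableSet_Ioo fun ρ _ => ?_
  have hper : ∫ θ in Set.Ioo (-Real.pi) Real.pi, F (circleMap 0 ρ θ) =
      ∫ θ in (0 : ℝ)..2 * Real.pi, F (circleMap 0 ρ θ) := by
    rw [← integral_Ioc_eq_integral_Ioo,
      ← intervalIntegral.integral_of_le (by linarith [Real.pi_pos])]
    have t₀ : (fun θ ↦ F (circleMap 0 ρ θ)).Periodic (2 * Real.pi) :=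
      fun x ↦ by simp [periodic_circleMap 0 ρ x]
    have := t₀.intervalIntegral_add_eq (-Real.pi) 0
    rw [zero_add] at this
    rw [← this]
    congr 1; ring
  dsimp only
  rw [integral_smul, hper, Real.circleAverage_def, Complex.real_smul, Complex.real_smul]
  have : (Real.pi : ℂ) ≠ 0 := by exact_mod_cast Real.pi_ne_zero
  push_cast
  field_simp

/-- The value `B(M + 1, n + 1)` of the beta function, after the substitution `s = ρ²`. -/
theorem integral_beta (n : ℕ) : ∀ M : ℕ,
    ∫ ρ in (0 : ℝ)..1, 2 * ρ ^ (2 * M + 1) * (1 - ρ ^ 2) ^ n =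
      (M.factorial * n.factorial : ℝ) / (M + n + 1).factorial := by
  induction n with
  | zero =>
    intro M
    simp only [pow_zero, mul_one, intervalIntegral.integral_const_mul, integral_pow,
      Nat.factorial_zero, add_zero, Nat.factorial_succ]
    push_cast
    have : (M.factorial : ℝ) ≠ 0 := by positivity
    field_simp
    simp
    ring
  | succ n ih =>
    intro M
    have e : ∀ ρ : ℝ, 2 * ρ ^ (2 * M + 1) * (1 - ρ ^ 2) ^ (n + 1) =
        2 * ρ ^ (2 * M + 1) * (1 - ρ ^ 2) ^ n - 2 * ρ ^ (2 * (M + 1) + 1) * (1 - ρ ^ 2) ^ n :=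
      fun ρ => by ring
    simp only [e]
    rw [intervalIntegral.integral_sub ((by fun_prop : Continuous _).intervalIntegrable _ _)
      ((by fun_prop : Continuous _).intervalIntegrable _ _), ih, ih]
    rw [show M + (n + 1) + 1 = M + n + 1 + 1 by ring, show M + 1 + n + 1 = M + n + 1 + 1 by ring,
      Nat.factorial_succ (M + n + 1), Nat.factorial_succ M, Nat.factorial_succ n]
    have : ((M + n + 1).factorial : ℝ) ≠ 0 := by positivity
    push_cast
    field_simp
    ring

theorem eventually_mem_Ioo : ∀ᶠ r : ℝ in 𝓝[<] 1, 0 < r ∧ r < 1 :=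
  Ioo_mem_nhdsLT one_pos

theorem dirichletIntegral_zero_eq (μ : Distribution) {a : ℕ → ℂ} {f : ℂ → ℂ}
    (hf : HasTaylor a f) (ha : RapidDecay a) :
    dirichletIntegral μ 0 f = ∑' q, formTerm μ.hat 0 a q := by
  refine Tendsto.limUnder_eq ?_
  have h : Tendsto (fun r : ℝ => ∑' q : ℕ × ℕ, formTerm μ.hat 0 a q * (r : ℂ) ^ (2 * max q.1 q.2))
      (𝓝[<] 1) (𝓝 (∑' q, formTerm μ.hat 0 a q)) := by
    refine tendsto_tsum_of_dominated_convergence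
      (summable_norm_formTerm μ.exists_hat_bound 0 ha) (fun q => ?_) ?_
    · have : Continuous fun r : ℝ => formTerm μ.hat 0 a q * (r : ℂ) ^ (2 * max q.1 q.2) := by
        fun_prop
      have h1 := this.tendsto 1
      simp only [Complex.ofReal_one, one_pow, mul_one] at h1
      exact h1.mono_left nhdsWithin_le_nhds
    · filter_upwards [eventually_mem_Ioo] with r hr q
      rw [norm_mul, norm_pow, Complex.norm_real, Real.norm_of_nonneg hr.1.le]
      exact mul_le_of_le_one_right (norm_nonneg _) (pow_le_one₀ hr.1.le hr.2.le)
  refine h.congr' ?_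
  filter_upwards [eventually_mem_Ioo] with r hr
  exact (hasSum_circleAverage μ ha hf hr.1.le hr.2).tsum_eq

/-- The factorials coming from `f^{(n+1)}`, from the beta integral and from the normalization of
`𝒟_{μ,n+1}` combine to the binomial coefficient `C(min(k, l) + n + 1, n + 1)`. -/
theorem formTerm_derivCoeff (c : ℤ → ℂ) (a : ℕ → ℂ) (n k l : ℕ) :
    ((((n + 1).factorial * n.factorial : ℕ) : ℂ) * (Real.pi : ℂ))⁻¹ *
      (formTerm c 0 (derivCoeff a (n + 1)) (k, l) *
        ((Real.pi * ((max k l).factorial * n.factorial / (max k l + n + 1).factorial) : ℝ) : ℂ)) =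
      formTerm c (n + 1) a (k + (n + 1), l + (n + 1)) := by
  have hpi : (Real.pi : ℂ) ≠ 0 := by exact_mod_cast Real.pi_ne_zero
  have hd : ∀ k : ℕ, (k.factorial : ℂ) * ((k + (n + 1)).descFactorial (n + 1) : ℂ) =
      ((k + (n + 1)).factorial : ℂ) := fun k => by
    have := Nat.factorial_mul_descFactorial (n := k + (n + 1)) (k := n + 1) (by omega)
    rw [Nat.add_sub_cancel] at this
    exact_mod_cast this
  have hch : ((min k l + (n + 1)).choose (n + 1) : ℂ) * ((n + 1).factorial : ℂ) =
      ((min k l + (n + 1)).descFactorial (n + 1) : ℂ) := by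
    rw [Nat.descFactorial_eq_factorial_mul_choose]; push_cast; ring
  have hmm : ((k + (n + 1)).descFactorial (n + 1) : ℂ) * ((l + (n + 1)).descFactorial (n + 1) : ℂ) =
      ((min k l + (n + 1)).descFactorial (n + 1) : ℂ) *
        ((max k l + (n + 1)).descFactorial (n + 1) : ℂ) := by
    rcases le_total k l with h | h
    · rw [min_eq_left h, max_eq_right h]
    · rw [min_eq_right h, max_eq_left h, mul_comm]
  have h1 : min (k + (n + 1)) (l + (n + 1)) = min k l + (n + 1) := by omega
  have h2 : ((l + (n + 1) : ℕ) : ℤ) - ((k + (n + 1) : ℕ) : ℤ) = (l : ℤ) - k := by push_cast; ring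
  simp only [formTerm, derivCoeff, Nat.choose_zero_right, h1, h2, map_mul, Complex.conj_natCast]
  have hM := hd (max k l)
  rw [show max k l + n + 1 = max k l + (n + 1) by ring]
  have f1 : ((max k l + (n + 1)).factorial : ℂ) ≠ 0 := by exact_mod_cast Nat.factorial_ne_zero _
  have f2 : (n.factorial : ℂ) ≠ 0 := by exact_mod_cast Nat.factorial_ne_zero _
  have f3 : ((n + 1).factorial : ℂ) ≠ 0 := by exact_mod_cast Nat.factorial_ne_zero _
  push_cast
  have key : ((k + (n + 1)).descFactorial (n + 1) : ℂ) *
      ((l + (n + 1)).descFactorial (n + 1) : ℂ) * ((max k l).factorial : ℂ) =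
      ((min k l + (n + 1)).choose (n + 1) : ℂ) * ((n + 1).factorial : ℂ) *
        ((max k l + (n + 1)).factorial : ℂ) := by
    rw [hmm, ← hM, hch]; ring
  field_simp
  linear_combination c (l - k) * a (k + (n + 1)) * conj (a (l + (n + 1))) * key

theorem dirichletIntegral_succ_eq (μ : Distribution) {a : ℕ → ℂ} {f : ℂ → ℂ}
    (hf : HasTaylor a f) (ha : RapidDecay a) (n : ℕ) :
    dirichletIntegral μ (n + 1) f = ∑' q, formTerm μ.hat (n + 1) a q := by
  set b := derivCoeff a (n + 1)
  have hbr : RapidDecay b := rapidDecay_derivCoeff ha _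
  have hg : HasTaylor b (iteratedDeriv (n + 1) f) := hf.hasTaylor_iteratedDeriv ha _
  set g := iteratedDeriv (n + 1) f
  set F : ℂ → ℂ := fun z => ((‖g z‖ ^ 2 : ℝ) : ℂ) * μ.poisson z *
    (((1 - ‖z‖ ^ 2) ^ n : ℝ) : ℂ) with hF
  have hFc : ContinuousOn F (Metric.ball 0 1) := by
    have h1 : ContinuousOn (fun z => ((‖g z‖ ^ 2 : ℝ) : ℂ)) (Metric.ball 0 1) :=
      Complex.continuous_ofReal.comp_continuousOn ((hg.continuousOn hbr).norm.pow 2)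
    exact (h1.mul (continuousOn_poisson μ)).mul (by fun_prop)
  set w : ℕ → ℝ → ℝ := fun M ρ => Real.pi * (2 * ρ ^ (2 * M + 1) * (1 - ρ ^ 2) ^ n) with hw
  have hwc : ∀ M, Continuous (w M) := fun M => by simp only [hw]; fun_prop
  have hwb : ∀ M, ∀ ρ : ℝ, 0 ≤ ρ → ρ ≤ 1 → ‖w M ρ‖ ≤ Real.pi * 2 := by
    intro M ρ h0 h1
    have h2 : 0 ≤ 1 - ρ ^ 2 := by nlinarith
    have h3 : 1 - ρ ^ 2 ≤ 1 := by nlinarith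
    have h4 : ρ ^ (2 * M + 1) * (1 - ρ ^ 2) ^ n ≤ 1 * 1 :=
      mul_le_mul (pow_le_one₀ h0 h1) (pow_le_one₀ h2 h3) (by positivity) zero_le_one
    rw [Real.norm_of_nonneg (by positivity)]
    simp only [hw]
    have := Real.pi_pos
    gcongr
    linarith
  have hN := summable_norm_formTerm μ.exists_hat_bound 0 hbr
  have hsum : ∀ r : ℝ, 0 < r → r < 1 → ∑' q : ℕ × ℕ, formTerm μ.hat 0 b q *
      ((∫ ρ in (0 : ℝ)..r, w (max q.1 q.2) ρ : ℝ) : ℂ) = ∫ z in Metric.ball (0 : ℂ) r, F z := by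
    intro r hr0 hr1
    rw [integral_ball_eq hFc hr0.le hr1]
    have h := intervalIntegral.hasSum_integral_of_dominated_convergence (μ := volume)
      (a := 0) (b := r) (F := fun (q : ℕ × ℕ) (ρ : ℝ) => formTerm μ.hat 0 b q *
        ((w (max q.1 q.2) ρ : ℝ) : ℂ))
      (f := fun ρ => ((2 * Real.pi * ρ : ℝ) : ℂ) * Real.circleAverage F 0 ρ)
      (fun q _ => ‖formTerm μ.hat 0 b q‖ * (Real.pi * 2))
      (fun q => by
        have := hwc (max q.1 q.2)
        exact (by fun_prop : Continuous _).aestronglyMeasurable)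
      (fun q => .of_forall fun ρ hρ => by
        rw [Set.uIoc_of_le hr0.le] at hρ
        rw [norm_mul, Complex.norm_real]
        gcongr
        exact hwb _ _ hρ.1.le (hρ.2.trans hr1.le))
      (.of_forall fun ρ _ => hN.mul_right _) (by simp)
      (.of_forall fun ρ hρ => by
        rw [Set.uIoc_of_le hr0.le] at hρ
        have hρ1 : ρ < 1 := hρ.2.trans_lt hr1
        have h1 := hasSum_circleAverage μ hbr hg hρ.1.le hρ1
        have h2 : Real.circleAverage F 0 ρ = (((1 - ρ ^ 2) ^ n : ℝ) : ℂ) *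
            Real.circleAverage (fun z => ((‖g z‖ ^ 2 : ℝ) : ℂ) * μ.poisson z) 0 ρ := by
          rw [← smul_eq_mul, ← Real.circleAverage_fun_smul]
          refine Real.circleAverage_congr_sphere fun z hz => ?_
          have hz' : ‖z‖ = ρ := by simpa [abs_of_pos hρ.1] using hz
          simp only [hF, hz', smul_eq_mul]
          ring
        rw [h2, ← mul_assoc]
        have h3 := h1.mul_left ((2 * Real.pi * ρ : ℝ) * (((1 - ρ ^ 2) ^ n : ℝ) : ℂ))
        have e : (fun q : ℕ × ℕ => formTerm μ.hat 0 b q * ((w (max q.1 q.2) ρ : ℝ) : ℂ)) =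
            fun q : ℕ × ℕ => (2 * Real.pi * ρ : ℝ) * (((1 - ρ ^ 2) ^ n : ℝ) : ℂ) *
              (formTerm μ.hat 0 b q * (ρ : ℂ) ^ (2 * max q.1 q.2)) := by
          funext q
          simp only [hw]
          push_cast
          ring
        rw [e]
        exact h3)
    rw [← h.tsum_eq]
    refine tsum_congr fun q => ?_
    exact ((intervalIntegral.integral_const_mul _ _).trans
      (by rw [intervalIntegral.integral_ofReal])).symm
  have hlim : Tendsto (fun r : ℝ => ∑' q : ℕ × ℕ, formTerm μ.hat 0 b q *
      ((∫ ρ in (0 : ℝ)..r, w (max q.1 q.2) ρ : ℝ) : ℂ)) (𝓝[<] 1)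
      (𝓝 (∑' q : ℕ × ℕ, formTerm μ.hat 0 b q *
        ((∫ ρ in (0 : ℝ)..1, w (max q.1 q.2) ρ : ℝ) : ℂ))) := by
    refine tendsto_tsum_of_dominated_convergence (hN.mul_right (Real.pi * 2)) (fun q => ?_) ?_
    · have h1 : Continuous fun r : ℝ => ∫ ρ in (0 : ℝ)..r, w (max q.1 q.2) ρ :=
        intervalIntegral.continuous_primitive
          (fun a b => (hwc _).intervalIntegrable a b) 0
      have h2 : Continuous fun r : ℝ => formTerm μ.hat 0 b q *
        ((∫ ρ in (0 : ℝ)..r, w (max q.1 q.2) ρ : ℝ) : ℂ) := by fun_prop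
      exact (h2.tendsto 1).mono_left nhdsWithin_le_nhds
    · filter_upwards [eventually_mem_Ioo] with r hr q
      rw [norm_mul, Complex.norm_real]
      gcongr
      have := intervalIntegral.norm_integral_le_of_norm_le_const (a := 0) (b := r)
        (f := w (max q.1 q.2)) (C := Real.pi * 2) fun ρ hρ => by
          rw [Set.uIoc_of_le hr.1.le] at hρ
          exact hwb _ _ hρ.1.le (hρ.2.trans hr.2.le)
      refine this.trans ?_
      rw [sub_zero, abs_of_pos hr.1]
      exact mul_le_of_le_one_right (by positivity) hr.2.le
  have hval : ((((n + 1).factorial * n.factorial : ℕ) : ℂ) * (Real.pi : ℂ))⁻¹ *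
      ∑' q : ℕ × ℕ, formTerm μ.hat 0 b q * ((∫ ρ in (0 : ℝ)..1, w (max q.1 q.2) ρ : ℝ) : ℂ) =
      ∑' q, formTerm μ.hat (n + 1) a q := by
    have hinj : Function.Injective fun q : ℕ × ℕ => (q.1 + (n + 1), q.2 + (n + 1)) := by
      rintro ⟨x, y⟩ ⟨x', y'⟩ h
      simp at h
      simp [h]
    -- The form of order `n + 1` has no terms with an index below `n + 1`.
    have hsupp : Function.support (formTerm μ.hat (n + 1) a) ⊆
        Set.range fun q : ℕ × ℕ => (q.1 + (n + 1), q.2 + (n + 1)) := by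
      rintro ⟨x, y⟩ hq
      have hx : n + 1 ≤ min x y := by
        by_contra h
        refine hq ?_
        simp only [formTerm]
        rw [Nat.choose_eq_zero_of_lt (by omega)]
        simp
      exact ⟨(x - (n + 1), y - (n + 1)), by
        simp only [Prod.mk.injEq]; omega⟩
    rw [← tsum_mul_left, ← hinj.tsum_eq hsupp]
    refine tsum_congr fun q => ?_
    rw [← formTerm_derivCoeff]
    congr 3
    simp only [hw]
    rw [intervalIntegral.integral_const_mul, integral_beta]
  refine Tendsto.limUnder_eq ?_
  rw [← hval]
  refine (hlim.const_mul _).congr' ?_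
  filter_upwards [eventually_mem_Ioo] with r hr
  rw [hsum r hr.1 hr.2]

/-- The Dirichlet integral of order `n` of `f = ∑ a_k z^k` is
`∑_{i,j} C(min(i,j), n) μ̂(j - i) a_i ā_j`. -/
theorem dirichletIntegral_eq (μ : Distribution) {a : ℕ → ℂ} {f : ℂ → ℂ}
    (hf : HasTaylor a f) (ha : RapidDecay a) (n : ℕ) :
    dirichletIntegral μ n f = ∑' q, formTerm μ.hat n a q := by
  cases n with
  | zero => exact dirichletIntegral_zero_eq μ hf ha
  | succ n => exact dirichletIntegral_succ_eq μ hf ha n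

/-! ### Taylor coefficients of functions in `𝒟_a` -/

theorem IsSmoothAnalytic.contDiff_circle {f : ℂ → ℂ} (hf : IsSmoothAnalytic f) :
    ContDiff ℝ ∞ fun t : ℝ => f (Circle.exp t) := by
  have h1 : ContDiff ℝ ∞ fun t : ℝ => (Circle.exp t : ℂ) := by
    simp only [Circle.coe_exp]
    exact (Complex.ofRealCLM.contDiff.mul contDiff_const).cexp
  rw [← contDiffOn_univ] at h1 ⊢
  exact hf.2.comp h1 fun t _ => by simp

theorem IsSmoothAnalytic.rapidDecay_hatA {f : ℂ → ℂ} (hf : IsSmoothAnalytic f) :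
    RapidDecay fun k => hatA f k := by
  intro N
  obtain ⟨B, hB⟩ := circleCoeff_decay ⟨fun ζ : Circle => f ζ, hf.contDiff_circle⟩ N
  exact ⟨B, fun k => by simpa [hatA] using hB k⟩

theorem IsSmoothAnalytic.hasTaylor_hatA {f : ℂ → ℂ} (hf : IsSmoothAnalytic f) :
    HasTaylor (fun k => hatA f k) f := by
  intro z hz
  have hd : DiffContOnCl ℂ f (Metric.ball 0 ((1 : NNReal) : ℝ)) := by
    refine ⟨by simpa using hf.1, ?_⟩
    rw [closure_ball _ (by simp)]
    simpa using hf.2.continuousOn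
  have h := (hd.hasFPowerSeriesOnBall one_pos).hasSum (y := z) (by
    rw [Metric.eball_coe]; simpa using hz)
  rw [zero_add] at h
  have e : (fun k : ℕ => hatA f k * z ^ k) =
      fun k => (cauchyPowerSeries f 0 ((1 : NNReal) : ℝ) k) fun _ => z := by
    funext k
    rw [cauchyPowerSeries_apply, hatA, circleCoeff, circleIntegral, NNReal.coe_one]
    have e' : ∀ t : ℝ, deriv (circleMap 0 1) t • (z / (circleMap 0 1 t - 0)) ^ k •
        (circleMap 0 1 t - 0)⁻¹ • f (circleMap 0 1 t) =
        (Complex.I * z ^ k) * (f (Circle.exp t) * (Circle.exp t : ℂ) ^ (-(k : ℤ))) := by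
      intro t
      have h1 : circleMap 0 1 t = Circle.exp t := by simp [circleMap, Circle.coe_exp]
      have h0 : (Circle.exp t : ℂ) ≠ 0 := Circle.coe_ne_zero _
      rw [deriv_circleMap, h1, sub_zero, zpow_neg, zpow_natCast]
      simp only [smul_eq_mul, div_pow]
      field_simp
    simp only [e']
    rw [intervalIntegral.integral_const_mul, smul_eq_mul]
    have : (Real.pi : ℂ) ≠ 0 := by exact_mod_cast Real.pi_ne_zero
    field_simp
  rw [e]
  exact h

theorem isSmoothAnalytic_sum (a : ℕ → ℂ) (s : Finset ℕ) :
    IsSmoothAnalytic fun z => ∑ k ∈ s, a k * z ^ k := by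
  refine ⟨by fun_prop, ContDiff.contDiffOn ?_⟩
  exact ContDiff.sum fun k _ => contDiff_const.mul (contDiff_id.pow k)

theorem hatA_sum_zero (a : ℕ → ℂ) {N : ℕ} (hN : 0 < N) :
    hatA (fun z => ∑ k ∈ range N, a k * z ^ k) 0 = a 0 := by
  have h1 := (isSmoothAnalytic_sum a (range N)).hasTaylor_hatA 0 (by simp)
  have h2 := h1.unique (hasSum_single (f := fun k : ℕ =>
    hatA (fun z => ∑ k ∈ range N, a k * z ^ k) k * (0 : ℂ) ^ k) 0 fun k hk => by simp [hk])
  simp only [pow_zero, mul_one, Nat.cast_zero] at h2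
  rw [← h2, sum_eq_single 0 (fun k _ hk => by simp [hk]) (fun h => by simp at h; omega)]
  simp

theorem dirichletIntegral_sum (μ : Distribution) (a : ℕ → ℂ) (n N : ℕ) :
    dirichletIntegral μ n (fun z => ∑ k ∈ range N, a k * z ^ k) =
      dirForm μ.hat n (range N) a := by
  set b : ℕ → ℂ := fun k => if k < N then a k else 0 with hb
  have hbr : RapidDecay b := fun M => by
    refine ⟨∑ k ∈ range N, (1 + (k : ℝ)) ^ M * ‖b k‖, fun k => ?_⟩
    by_cases hk : k < N
    · exact single_le_sum (f := fun k : ℕ => (1 + (k : ℝ)) ^ M * ‖b k‖)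
        (fun k _ => by positivity) (mem_range.2 hk)
    · simp only [hb, if_neg hk, norm_zero, mul_zero]
      exact sum_nonneg fun k _ => by positivity
  have hbt : HasTaylor b fun z => ∑ k ∈ range N, a k * z ^ k := fun z _ => by
    have : HasSum (fun k => b k * z ^ k) (∑ k ∈ range N, b k * z ^ k) :=
      hasSum_sum_of_ne_finset_zero fun k hk => by
        simp only [mem_range] at hk; simp [hb, hk]
    convert this using 1
    exact sum_congr rfl fun k hk => by simp only [hb, if_pos (mem_range.1 hk)]
  rw [dirichletIntegral_eq μ hbt hbr, tsum_eq_sum (s := range N ×ˢ range N), sum_product, dirForm]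
  · refine sum_congr rfl fun i hi => sum_congr rfl fun j hj => ?_
    simp only [formTerm, hb, if_pos (mem_range.1 hi), if_pos (mem_range.1 hj)]
  · intro q hq
    simp only [mem_product, mem_range, not_and_or] at hq
    rcases hq with h | h <;> simp [formTerm, hb, h]

/-! ### Fourier coefficients of distributions -/

theorem coe_monomial (k : ℤ) (ζ : Circle) : (monomial k : Circle → ℂ) ζ = (ζ : ℂ) ^ k := rfl

namespace Distribution

variable {μ : Distribution}

/-- The Toeplitz form of `μ̂` at a finite sequence `a` is `μ(|∑ a_k ζ^k|²)`. -/
theorem IsPositive.posSeq (hμ : μ.IsPositive) : PosSeq μ.hat := by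
  intro s a
  set F : TestFunction := ∑ i ∈ s, ∑ j ∈ s, (a i * conj (a j)) • monomial ((i : ℤ) - j) with hF
  have hval : ∀ ζ : Circle, (F : Circle → ℂ) ζ =
      (∑ i ∈ s, a i * (ζ : ℂ) ^ i) * conj (∑ i ∈ s, a i * (ζ : ℂ) ^ i) := by
    intro ζ
    have h0 : (ζ : ℂ) ≠ 0 := Circle.coe_ne_zero _
    rw [hF, map_sum, sum_mul_sum]
    simp only [Submodule.coe_sum, Finset.sum_apply, Submodule.coe_smul, Pi.smul_apply,
      coe_monomial, smul_eq_mul]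
    refine sum_congr rfl fun i _ => sum_congr rfl fun j _ => ?_
    rw [map_mul, map_pow, ← Circle.coe_inv_eq_conj, zpow_sub₀ h0, zpow_natCast, zpow_natCast,
      Circle.coe_inv, inv_pow]
    ring
  have h := hμ F fun ζ => by rw [hval]; exact mul_star_self_nonneg _
  convert h using 1
  simp only [dirForm, hF, eval, map_sum, map_smul, smul_eq_mul, hat, Nat.choose_zero_right,
    Nat.cast_one, one_mul, neg_sub]
  exact sum_congr rfl fun i _ => sum_congr rfl fun j _ => mul_comm _ _

theorem IsReal.hat_neg (hμ : μ.IsReal) (k : ℤ) : μ.hat (-k) = conj (μ.hat k) := by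
  have hc : ∀ ζ : Circle, (ζ : ℂ) ^ (-k) = conj ((ζ : ℂ) ^ k) := fun ζ => by
    rw [zpow_neg, map_zpow₀, ← Circle.coe_inv_eq_conj, Circle.coe_inv, inv_zpow]
  have h1 := hμ (monomial k + monomial (-k)) fun ζ => by
    change ((ζ : ℂ) ^ k + (ζ : ℂ) ^ (-k)).im = 0
    rw [hc, Complex.add_im, Complex.conj_im, add_neg_cancel]
  have h2 := hμ (Complex.I • (monomial k - monomial (-k))) fun ζ => by
    change (Complex.I * ((ζ : ℂ) ^ k - (ζ : ℂ) ^ (-k))).im = 0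
    rw [hc]
    simp [-map_zpow₀]
  simp only [eval, map_add, map_smul, map_sub, smul_eq_mul, Complex.add_im, Complex.mul_im,
    Complex.I_re, Complex.I_im, zero_mul, one_mul, zero_add, Complex.sub_re] at h1 h2
  simp only [hat, eval, neg_neg]
  apply Complex.ext <;> simp <;> linarith

theorem hat_zero_eq (μ : Distribution) : μ.hat 0 = μ.eval (monomial 0) := by simp [hat]

/-- A positive distribution with `μ(1) = 0` vanishes: a real test function `f` with `|f| ≤ M` has
`M ± f ≥ 0`, hence `± μ(f) ≥ 0`. -/
theorem IsPositive.hat_zero_pos (hμ : μ.IsPositive) (h0 : μ ≠ 0) : 0 < (μ.hat 0).re := by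
  refine lt_of_le_of_ne hμ.posSeq.zero_re_nonneg fun hz => h0 ?_
  have hz' : μ.eval (monomial 0) = 0 := by
    rw [← hat_zero_eq]
    have h1 := hμ.posSeq {0} fun _ => 1
    simp only [dirForm, sum_singleton] at h1
    simp at h1
    exact Complex.ext hz.symm (Complex.nonneg_iff.1 h1).2.symm
  have hbdd : ∀ f : TestFunction, ∃ M : ℝ, ∀ ζ : Circle, ‖(f : Circle → ℂ) ζ‖ ≤ M := by
    intro f
    have hf : ContDiff ℝ ∞ fun t : ℝ => (f : Circle → ℂ) (Circle.exp t) := f.2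
    obtain ⟨M, hM⟩ := isCompact_Icc.exists_bound_of_continuousOn
      (s := Set.Icc (-Real.pi) Real.pi) hf.continuous.continuousOn
    refine ⟨M, fun ζ => ?_⟩
    have := hM (Complex.arg ζ) ⟨(Complex.neg_pi_lt_arg _).le, Complex.arg_le_pi _⟩
    rwa [Circle.exp_arg] at this
  have hreal : ∀ f : TestFunction, (∀ ζ, ((f : Circle → ℂ) ζ).im = 0) → μ.eval f = 0 := by
    intro f hf
    obtain ⟨M, hM⟩ := hbdd f
    have key : ∀ σ : ℝ, |σ| = 1 → 0 ≤ (σ : ℂ) * μ.eval f := by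
      intro σ hσ
      have h := hμ ((M : ℂ) • monomial 0 + (σ : ℂ) • f) fun ζ => by
        have h1 : (M : ℂ) * (ζ : ℂ) ^ (0 : ℤ) + (σ : ℂ) * (f : Circle → ℂ) ζ =
            ((M + σ * ((f : Circle → ℂ) ζ).re : ℝ) : ℂ) := by
          apply Complex.ext <;> simp [hf ζ]
        change 0 ≤ (M : ℂ) * (ζ : ℂ) ^ (0 : ℤ) + (σ : ℂ) * (f : Circle → ℂ) ζ
        rw [h1]
        have h2 : |σ * ((f : Circle → ℂ) ζ).re| ≤ M := by
          rw [abs_mul, hσ, one_mul]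
          exact (Complex.abs_re_le_norm _).trans (hM ζ)
        exact_mod_cast by linarith [(abs_le.1 h2).1]
      rw [eval, map_add, map_smul, map_smul] at h
      change 0 ≤ (M : ℂ) * μ.eval (monomial 0) + (σ : ℂ) * μ.eval f at h
      rwa [hz', mul_zero, zero_add] at h
    have h1 := key 1 (by simp)
    have h2 := key (-1) (by simp)
    simp only [Complex.ofReal_one, one_mul, Complex.ofReal_neg, neg_mul] at h1 h2
    exact le_antisymm (neg_nonneg.1 h2) h1
  apply Subtype.ext
  refine LinearMap.ext fun f => ?_
  have hre : ContDiff ℝ ∞ fun t : ℝ => (((f : Circle → ℂ) (Circle.exp t)).re : ℂ) :=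
    Complex.ofRealCLM.contDiff.comp (Complex.reCLM.contDiff.comp f.2)
  have him : ContDiff ℝ ∞ fun t : ℝ => (((f : Circle → ℂ) (Circle.exp t)).im : ℂ) :=
    Complex.ofRealCLM.contDiff.comp (Complex.imCLM.contDiff.comp f.2)
  set g : TestFunction := ⟨fun ζ => (((f : Circle → ℂ) ζ).re : ℂ), hre⟩
  set h : TestFunction := ⟨fun ζ => (((f : Circle → ℂ) ζ).im : ℂ), him⟩
  have e : f = g + Complex.I • h := by
    apply Subtype.ext
    funext ζ
    change (f : Circle → ℂ) ζ = (((f : Circle → ℂ) ζ).re : ℂ) +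
      Complex.I * (((f : Circle → ℂ) ζ).im : ℂ)
    rw [mul_comm, Complex.re_add_im]
  have hg := hreal g fun ζ => Complex.ofReal_im _
  have hh := hreal h fun ζ => Complex.ofReal_im _
  rw [e, map_add, map_smul]
  change μ.eval g + Complex.I * μ.eval h = 0
  rw [hg, hh]; simp

theorem IsFiniteMeasure.exists_norm_hat_le (hμ : μ.IsFiniteMeasure) :
    ∃ K : ℝ, 0 ≤ K ∧ ∀ k, ‖μ.hat k‖ ≤ K := by
  obtain ⟨σ, hσ⟩ := hμ
  have hfin : ∀ s : SignedMeasure Circle, MeasureTheory.IsFiniteMeasure s.variation := fun s => by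
    rw [← SignedMeasure.totalVariation_eq_variation]
    unfold SignedMeasure.totalVariation
    infer_instance
  have hb : ∀ s : SignedMeasure Circle, ∃ K : ℝ, ∀ k : ℤ,
      ‖∫ᵛ ζ, (monomial k : Circle → ℂ) ζ ∂<•s‖ ≤ K := fun s => by
    have := hfin s
    refine ⟨_, fun k => VectorMeasure.norm_integral_le_of_norm_le_const (C := 1) ?_⟩
    exact .of_forall fun ζ => by rw [coe_monomial, norm_zpow, Circle.norm_coe, one_zpow]
  obtain ⟨K, hK⟩ := hb (ComplexMeasure.re σ)
  obtain ⟨L, hL⟩ := hb (ComplexMeasure.im σ)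
  refine ⟨K + L, add_nonneg ((norm_nonneg _).trans (hK 0)) ((norm_nonneg _).trans (hL 0)),
    fun k => ?_⟩
  rw [hat, hσ]
  refine (norm_add_le _ _).trans (add_le_add (hK _) ?_)
  rw [norm_mul, Complex.norm_I, one_mul]
  exact hL _

theorem hat_add (μ κ : Distribution) (k : ℤ) : (μ + κ).hat k = μ.hat k + κ.hat k := rfl

theorem hat_smul (c : ℂ) (μ : Distribution) (k : ℤ) : (c • μ).hat k = c * μ.hat k := rfl

theorem hat_sum {ι : Type*} (s : Finset ι) (κ : ι → Distribution) (k : ℤ) :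
    (∑ i ∈ s, κ i).hat k = ∑ i ∈ s, (κ i).hat k := by
  simp [hat, eval, LinearMap.sum_apply]

theorem hat_iterate_D (μ : Distribution) (j : ℕ) (k : ℤ) :
    (D^[j] μ).hat k = ((|k| : ℤ) : ℂ) ^ j * μ.hat k := by
  induction j with
  | zero => simp
  | succ j ih => rw [Function.iterate_succ_apply', hat_D, ih, pow_succ]; ring

end Distribution

theorem IsSumOfDerivatives.exists_norm_hat_le {μ : Distribution} {J : ℕ}
    (hμ : IsSumOfDerivatives μ J) :
    ∃ K : ℝ, 0 ≤ K ∧ ∀ k : ℤ, ‖μ.hat k‖ ≤ K * (1 + |(k : ℝ)|) ^ J := by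
  obtain ⟨ν, hν, rfl⟩ := hμ
  choose K hK hb using fun j => (hν j).exists_norm_hat_le
  refine ⟨∑ j ∈ range (J + 1), K j, sum_nonneg fun j _ => hK j, fun k => ?_⟩
  rw [Distribution.hat_sum, sum_mul]
  refine (norm_sum_le _ _).trans (sum_le_sum fun j hj => ?_)
  have hk := abs_nonneg (k : ℝ)
  rw [Distribution.hat_iterate_D, norm_mul, norm_pow, Complex.norm_intCast, mul_comm]
  push_cast
  rw [abs_abs]
  have h1 : |(k : ℝ)| ^ j ≤ (1 + |(k : ℝ)|) ^ J := by
    calc |(k : ℝ)| ^ j ≤ (1 + |(k : ℝ)|) ^ j := by gcongr; linarith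
      _ ≤ _ := pow_le_pow_right₀ (by linarith) (by rw [mem_range] at hj; omega)
  exact mul_le_mul (hb j k) h1 (by positivity) (hK j)

/-! ### Multiplication by `z` and allowability -/

/-- The Taylor coefficients of `z f(z)` when `a` are those of `f`. -/
def shiftSeq (a : ℕ → ℂ) : ℕ → ℂ
  | 0 => 0
  | k + 1 => a k

theorem RapidDecay.shiftSeq {a : ℕ → ℂ} (ha : RapidDecay a) : RapidDecay (shiftSeq a) := by
  intro N
  obtain ⟨B, hB⟩ := ha N
  have hB0 : 0 ≤ B := le_trans (by positivity) (hB 0)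
  refine ⟨2 ^ N * B, fun k => ?_⟩
  cases k with
  | zero => simp only [CircleDist.shiftSeq, norm_zero, mul_zero]; positivity
  | succ k =>
    calc (1 + ((k + 1 : ℕ) : ℝ)) ^ N * ‖a k‖ ≤ (2 * (1 + (k : ℝ))) ^ N * ‖a k‖ := by
          gcongr; push_cast; linarith [Nat.cast_nonneg (α := ℝ) k]
      _ = 2 ^ N * ((1 + (k : ℝ)) ^ N * ‖a k‖) := by rw [mul_pow]; ring
      _ ≤ 2 ^ N * B := by gcongr; exact hB k

theorem HasTaylor.id_mul {a : ℕ → ℂ} {f : ℂ → ℂ} (hf : HasTaylor a f) :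
    HasTaylor (shiftSeq a) fun z => z * f z := by
  intro z hz
  rw [← hasSum_nat_add_iff' 1]
  have := (hf z hz).mul_left z
  simp only [range_one, sum_singleton, shiftSeq, zero_mul, sub_zero]
  have e : (fun k : ℕ => a k * z ^ (k + 1)) = fun k => z * (a k * z ^ k) := by
    funext k; ring
  rw [e]
  exact this

theorem dirForm_shiftSeq_zero (c : ℤ → ℂ) (N : ℕ) (a : ℕ → ℂ) :
    dirForm c 0 (range (N + 1)) (shiftSeq a) = dirForm c 0 (range N) a := by
  simp [dirForm, sum_range_succ', shiftSeq]

/-- Pascal's rule: multiplication by `z` adds to a form the form of the next lower order. -/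
theorem dirForm_shiftSeq_succ (c : ℤ → ℂ) (n N : ℕ) (a : ℕ → ℂ) :
    dirForm c (n + 1) (range (N + 1)) (shiftSeq a) =
      dirForm c (n + 1) (range N) a + dirForm c n (range N) a := by
  simp only [dirForm, sum_range_succ', shiftSeq, zero_mul, mul_zero, map_zero, sum_const_zero,
    add_zero, ← sum_add_distrib]
  refine sum_congr rfl fun i _ => sum_congr rfl fun j _ => ?_
  rw [Nat.add_min_add_right, Nat.choose_succ_succ]
  push_cast
  rw [add_sub_add_right_eq_sub]
  ring

theorem sum_dirForm_shiftSeq (d : ℕ → ℤ → ℂ) (M N : ℕ) (a : ℕ → ℂ) :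
    ∑ n ∈ range (M + 1), dirForm (d n) n (range (N + 1)) (shiftSeq a) =
      ∑ n ∈ range (M + 1), dirForm (d n) n (range N) a +
        ∑ n ∈ range M, dirForm (d (n + 1)) n (range N) a := by
  rw [sum_range_succ', sum_range_succ']
  simp only [dirForm_shiftSeq_succ, dirForm_shiftSeq_zero, sum_add_distrib]
  ring

theorem dirForm_linear (x y : ℂ) (c₁ c₂ c₃ : ℤ → ℂ) (n : ℕ) (s : Finset ℕ) (a : ℕ → ℂ) :
    dirForm (fun k => x * c₁ k + c₂ k + y * c₃ k) n s a =
      x * dirForm c₁ n s a + dirForm c₂ n s a + y * dirForm c₃ n s a := by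
  simp only [dirForm, mul_sum, ← sum_add_distrib]
  exact sum_congr rfl fun i _ => sum_congr rfl fun j _ => by ring

theorem dirForm_eq_re {c : ℤ → ℂ} (hc : ∀ k, c (-k) = conj (c k)) (n : ℕ) (s : Finset ℕ)
    (a : ℕ → ℂ) : dirForm c n s a = ((dirForm c n s a).re : ℂ) := by
  refine (Complex.conj_eq_iff_re.1 ?_).symm
  simp only [dirForm, map_sum, map_mul, Complex.conj_conj, Complex.conj_natCast, ← hc, neg_sub]
  rw [sum_comm]
  refine sum_congr rfl fun i _ => sum_congr rfl fun j _ => ?_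
  rw [min_comm]
  ring

theorem PosSeq.dirForm_zero_eq_re {c : ℤ → ℂ} (hc : PosSeq c) (s : Finset ℕ) (a : ℕ → ℂ) :
    dirForm c 0 s a = ((dirForm c 0 s a).re : ℂ) :=
  Complex.ext rfl (Complex.nonneg_iff.1 (hc s a)).2.symm

theorem tendsto_normSq {m : ℕ} (ρ : Fin m → Distribution) {a : ℕ → ℂ} {f : ℂ → ℂ}
    (hf : HasTaylor a f) (ha : RapidDecay a) :
    Tendsto (fun N => ∑ n : Fin m, dirForm (ρ n).hat n (range N) a) atTop (𝓝 (normSq ρ f)) := by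
  refine tendsto_finsetSum _ fun n _ => ?_
  rw [dirichletIntegral_eq _ hf ha]
  exact tendsto_dirForm (ρ n).exists_hat_bound n ha

/-- Allowability from inequalities for finite sections. It suffices that the form of the tuple is
nonnegative and dominates its own increment under multiplication by `z`; both survive the limit. -/
theorem allowable_of_dirForm_le {M : ℕ} (ρ : Fin (M + 1) → Distribution) (d : ℕ → ℤ → ℂ)
    (hd : ∀ n : Fin (M + 1), (ρ n).hat = d n) {C : ℝ} (hC : 0 < C) {N₀ : ℕ}
    (hnn : ∀ N a, N₀ < N → 0 ≤ ∑ n ∈ range (M + 1), dirForm (d n) n (range N) a)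
    (hle : ∀ N a, N₀ < N → ∑ n ∈ range M, dirForm (d (n + 1)) n (range N) a ≤
      C * ∑ n ∈ range (M + 1), dirForm (d n) n (range N) a) :
    Allowable ρ := by
  have hlim : ∀ {a : ℕ → ℂ} {f : ℂ → ℂ}, HasTaylor a f → RapidDecay a →
      Tendsto (fun N => ∑ n ∈ range (M + 1), dirForm (d n) n (range N) a) atTop
        (𝓝 (normSq ρ f)) := fun hf ha => by
    refine (tendsto_normSq ρ hf ha).congr fun N => ?_
    rw [← Fin.sum_univ_eq_sum_range (fun n => dirForm (d n) n (range N) _)]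
    exact sum_congr rfl fun n _ => by rw [hd]
  refine ⟨Real.sqrt (1 + C), by positivity, fun f hf => ?_⟩
  have ht := hf.hasTaylor_hatA
  have hr := hf.rapidDecay_hatA
  have h1 := hlim ht hr
  have h2 := hlim ht.id_mul hr.shiftSeq
  have hsq : ((Real.sqrt (1 + C) : ℝ) : ℂ) ^ 2 = 1 + (C : ℂ) := by
    rw [← Complex.ofReal_pow, Real.sq_sqrt (by positivity)]; push_cast; rfl
  refine ⟨ge_of_tendsto h2 ?_, ?_⟩
  · filter_upwards [eventually_gt_atTop N₀] with N hN using hnn N _ hN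
  · rw [hsq]
    refine le_of_tendsto_of_tendsto (h2.comp (tendsto_add_atTop_nat 1)) (h1.const_mul _) ?_
    filter_upwards [eventually_gt_atTop N₀] with N hN
    simp only [Function.comp]
    rw [sum_dirForm_shiftSeq, add_mul, one_mul]
    gcongr
    exact hle N _ hN

end CircleDist

open CircleDist Finset in
theorem theorem5p4 (m : ℕ) (hm : 4 ≤ m)
    (μ : Fin m → CircleDist.Distribution) (ν : CircleDist.Distribution)
    (hreal : ∀ n : Fin m, (μ n).IsReal)
    (hν : ν.IsPositive)
    (hν0 : ∃ K : ℝ, 0 < K ∧ ∀ f : ℂ → ℂ, CircleDist.IsSmoothAnalytic f →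
      ((‖CircleDist.hatA f 0‖ ^ 2 : ℝ) : ℂ) ≤ (K : ℂ) * CircleDist.dirichletIntegral ν 0 f)
    (hlow : ∀ n : Fin m, (n : ℝ) ≤ ((m : ℝ) - 4) / 2 →
      ∃ K : ℝ, 0 < K ∧ ∀ k : ℤ, ‖(μ n).hat k‖ ≤ K * (1 + |(k : ℝ)|) ^ (((m : ℝ) - 4) / 2))
    (hodd : ∀ n : Fin m, Odd m → (n : ℕ) = (m - 3) / 2 →
      CircleDist.IsSumOfDerivatives (μ n) ((m - 5) / 2))
    (hmid : ∀ n : Fin m, ((m : ℝ) - 2) / 2 ≤ (n : ℝ) → (n : ℕ) ≤ m - 3 →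
      CircleDist.IsSumOfDerivatives (μ n) (m - 3 - n))
    (hzero : μ ⟨m - 2, by omega⟩ = 0)
    (hpos : (μ ⟨m - 1, by omega⟩).IsPositive)
    (hne : μ ⟨m - 1, by omega⟩ ≠ 0) :
    ∃ C₀ : ℝ, 0 < C₀ ∧ ∀ C : ℝ, C₀ ≤ C →
      CircleDist.Allowable
        (Pi.single (⟨0, by omega⟩ : Fin m) ((C : ℂ) • ν) + μ +
          Pi.single (⟨m - 1, by omega⟩ : Fin m) ((C : ℂ) • μ ⟨m - 1, by omega⟩)) := by
  obtain ⟨p, rfl⟩ : ∃ p, m = p + 2 := ⟨m - 2, by omega⟩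
  have hp : 1 < p := by omega
  -- The coefficients of the `μ_n`, extended by zero to all `n : ℕ`.
  set c : ℕ → ℤ → ℂ := fun n => if h : n < p + 2 then (μ ⟨n, h⟩).hat else 0 with hc
  have hcn : ∀ n (h : n < p + 2), c n = (μ ⟨n, h⟩).hat := fun n h => by simp [hc, h]
  have hcherm : ∀ n k, c n (-k) = starRingEnd ℂ (c n k) := fun n k => by
    by_cases h : n < p + 2
    · rw [hcn n h]; exact (hreal _).hat_neg k
    · simp [hc, h]
  have hzero' : c p = 0 := by
    rw [hcn p (by omega)]
    change (μ ⟨p + 2 - 2, _⟩).hat = 0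
    rw [hzero]; rfl
  have htop : PosSeq (c (p + 1)) := by
    rw [hcn (p + 1) (by omega)]; exact hpos.posSeq
  have htop0 : 0 < (c (p + 1) 0).re := by
    rw [hcn (p + 1) (by omega)]; exact hpos.hat_zero_pos hne
  have hν0' : ∃ K : ℝ, 0 < K ∧ ∀ (N : ℕ) (a : ℕ → ℂ), 0 < N →
      ‖a 0‖ ^ 2 ≤ K * (dirForm ν.hat 0 (range N) a).re := by
    obtain ⟨K, hK, h⟩ := hν0
    refine ⟨K, hK, fun N a hN => ?_⟩
    have h1 := h _ (isSmoothAnalytic_sum a (range N))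
    rw [hatA_sum_zero a hN, dirichletIntegral_sum] at h1
    have h2 := (Complex.le_def.1 h1).1
    rwa [Complex.ofReal_re, Complex.re_ofReal_mul] at h2
  have hbound : ∀ n < p, ∃ K : ℝ, ∃ t : ℕ, 0 ≤ K ∧
      (∀ j : ℤ, ‖c n j‖ ^ 2 ≤ K ^ 2 * (1 + |(j : ℝ)|) ^ t) ∧
      ((2 * n ≤ p ∧ t + 2 ≤ p) ∨ (p ≤ 2 * n ∧ 2 * n + t + 2 ≤ 2 * p)) := by
    intro n hn
    have hsum : ∀ J, IsSumOfDerivatives (μ ⟨n, by omega⟩) J → ∃ K : ℝ, 0 ≤ K ∧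
        ∀ j : ℤ, ‖c n j‖ ^ 2 ≤ K ^ 2 * (1 + |(j : ℝ)|) ^ (2 * J) := by
      intro J hJ
      obtain ⟨K, hK, h⟩ := hJ.exists_norm_hat_le
      refine ⟨K, hK, fun j => ?_⟩
      rw [hcn n (by omega), mul_comm 2 J, pow_mul, ← mul_pow]
      gcongr
      exact h j
    -- The three cases are `n ≤ (m - 4) / 2`, `n = (m - 3) / 2` with `m` odd, and
    -- `(m - 2) / 2 ≤ n ≤ m - 3`, written with `p = m - 2`.
    rcases lt_trichotomy (2 * n + 1) p with h | h | h
    · obtain ⟨q, rfl⟩ : ∃ q, p = q + 2 := ⟨p - 2, by omega⟩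
      have e : (((q + 2 + 2 : ℕ) : ℝ) - 4) / 2 = (q : ℝ) / 2 := by push_cast; ring
      obtain ⟨K, hK, hb⟩ := hlow ⟨n, by omega⟩ (by
        rw [e, le_div_iff₀ two_pos]
        have : n * 2 ≤ q := by omega
        exact_mod_cast this)
      refine ⟨K, q, hK.le, fun j => ?_, Or.inl ⟨by omega, by omega⟩⟩
      have hj : (0 : ℝ) ≤ 1 + |(j : ℝ)| := by positivity
      have h1 : ((1 + |(j : ℝ)|) ^ ((q : ℝ) / 2)) ^ 2 = (1 + |(j : ℝ)|) ^ q := by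
        rw [← Real.rpow_mul_natCast hj, ← Real.rpow_natCast]
        congr 1; push_cast; ring
      rw [hcn n (by omega), ← h1, ← mul_pow, ← e]
      gcongr
      exact hb j
    · obtain ⟨K, hK, hb⟩ := hsum _ (hodd ⟨n, by omega⟩ ⟨n + 1, by omega⟩ (by simp; omega))
      exact ⟨K, _, hK, hb, Or.inl ⟨by omega, by omega⟩⟩
    · obtain ⟨K, hK, hb⟩ := hsum _ (hmid ⟨n, by omega⟩ (by
        have : (p : ℝ) ≤ 2 * n := by exact_mod_cast (by omega : p ≤ 2 * n)
        push_cast; linarith) (by simp; omega))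
      exact ⟨K, _, hK, hb, Or.inr ⟨by omega, by simp only; omega⟩⟩
  obtain ⟨C₀, hC₀, hmain⟩ :=
    exists_allowable_bounds hp hν.posSeq hν0' hbound hzero' htop htop0
  refine ⟨C₀, hC₀, fun C hC => ?_⟩
  obtain ⟨C₁, hC₁, hfin⟩ := hmain C hC
  -- The coefficients of the tuple `C ν e_0 + μ + C μ_{m-1} e_{m-1}`.
  set d : ℕ → ℤ → ℂ := fun n k => (if n = 0 then (C : ℂ) else 0) * ν.hat k + c n k +
    (if n = p + 1 then (C : ℂ) else 0) * c (p + 1) k with hd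
  have hlin : ∀ n n' N a, dirForm (d n) n' (range N) a =
      (if n = 0 then (C : ℂ) else 0) * dirForm ν.hat n' (range N) a + dirForm (c n) n' (range N) a +
        (if n = p + 1 then (C : ℂ) else 0) * dirForm (c (p + 1)) n' (range N) a :=
    fun n n' N a => dirForm_linear _ _ _ _ _ _ _ _
  have hF : ∀ N a, ∑ n ∈ range (p + 2), dirForm (d n) n (range N) a =
      ((C * (dirForm ν.hat 0 (range N) a).re +
        ∑ n ∈ range (p + 2), (dirForm (c n) n (range N) a).re +
        C * (dirForm (c (p + 1)) (p + 1) (range N) a).re : ℝ) : ℂ) := by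
    intro N a
    push_cast
    rw [← hν.posSeq.dirForm_zero_eq_re]
    simp only [← dirForm_eq_re (hcherm _), hlin, sum_add_distrib, ite_mul, zero_mul,
      sum_ite_eq', mem_range]
    simp
  have hG : ∀ N a, ∑ n ∈ range (p + 1), dirForm (d (n + 1)) n (range N) a =
      ((∑ n ∈ range (p + 1), (dirForm (c (n + 1)) n (range N) a).re +
        C * (dirForm (c (p + 1)) p (range N) a).re : ℝ) : ℂ) := by
    intro N a
    push_cast
    simp only [← dirForm_eq_re (hcherm _), hlin, sum_add_distrib, ite_mul, zero_mul,
      Nat.add_right_cancel_iff, sum_ite_eq', mem_range]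
    simp
  refine allowable_of_dirForm_le (M := p + 1) (N₀ := p) _ d (fun n => ?_) hC₁
    (fun N a hN => ?_) fun N a hN => ?_
  · funext k
    simp only [Pi.add_apply, Distribution.hat_add, hd, hcn n n.2, hcn (p + 1) (by omega)]
    congr 1
    · congr 1
      by_cases h : n = ⟨0, by omega⟩
      · subst h; simp [Distribution.hat_smul]
      · have h' : (n : ℕ) ≠ 0 := fun h' => h (Fin.ext h')
        rw [Pi.single_eq_of_ne h, if_neg h', zero_mul]; rfl
    · by_cases h : n = ⟨p + 2 - 1, by omega⟩
      · subst h; simp [Distribution.hat_smul]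
      · have h' : (n : ℕ) ≠ p + 1 := fun h' => h (Fin.ext h')
        rw [if_neg h', zero_mul, Pi.single_eq_of_ne h]; rfl
  · rw [hF]
    exact_mod_cast (hfin N a hN).1
  · rw [hF, hG, ← Complex.ofReal_mul]
    exact_mod_cast (hfin N a hN).2
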